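/- Definitions. Networks are finite simple undirected graphs $G=(V,E)$ with $n=|V|$ nodes. In the CONGEST model, computation proceeds in synchronous rounds; in each round every node may send one message of $O(\log n)$ bits over each of its edges, in each direction, and performs arbitrary local computation using its private random bits. A partition of $V$ into a core $\mathcal C$ and a periphery $\mathcal P=V\setminus\mathcal C$ makes $G$ a core-periphery network with constants $\alpha,\beta,\gamma$ if the following hold. 1. (Boundary) Every $v\in\mathcal C$ satisfies $\frac{d_{\rm out}(v)}{d_{\rm in}(v)+1}\le\alpha$, where $d_{\rm in}(v)$ and $d_{\rm out}(v)$ are the numbers of neighbours of $v$ inside and outside $\mathcal C$. 2. (Clique emulation) In the subgraph induced by $\mathcal C$, it is possible to deliver a message $M_{v,w}$ from $v$ to $w$, for all pairs $v,w\in\mathcal C$ simultaneously, within $\beta$ rounds. 3. (Convergecast) In $G$, it is possible to deliver messages $M_v$, one originating at each $v\in\mathcal P$, each to at least one node of $\mathcal C$, all within $\gamma$ rounds. Here, in 2 and 3, messages are delivered by store-and-forward: in every round a node may send one message that it already holds over each of its edges in each direction. An $n\times n$ matrix is $O(k)$-sparse if each of its rows and each of its columns has at most $sk$ nonzero entries,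 where $s$ is a constant. Matrix transposition is the following task: initially each node holds one row $A_{i,*}$ of $A$ together with its index $i$, different nodes holding different rows, and every entry of $A$ is represented by $O(\log n)$ bits; in the end, the node that initially holds $A_{i,*}$ must hold the row $A^T_{i,*}$ of the transpose. Theorem. On core-periphery networks, transposing an $O(k)$-sparse matrix can be completed in $O(k)$ rounds with high probability. Precisely: for all constants $\alpha,\beta,\gamma,s,c$, all constants in the $O(\log n)$ bounds on the lengths of messages and of entries, there is a constant $K$ such that for every $n$-node core-periphery network $G$ with constants $\alpha,\beta,\gamma$, every set of possible entries representable by $O(\log n)$ bits and every $k$, there is a randomized CONGEST algorithm on $G$ with the following property. For every $n\times n$ matrix $A$ with entries in that set and at most $sk$ nonzero entries in each row and each column, and for every assignment of the rows of $A$ to the nodes (one row per node), the algorithm completes the transposition of $A$ within $Kk$ rounds with probability at least $1-n^{-c}$. -/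

import Mathlib

/-! ### Store-and-forward delivery of messages

A message is an indivisible unit. In each round every node may send, over each of its edges
and in each direction, one message that it already holds. -/

section Delivery

/-- `σ t u v = some m` means that in round `t` node `u` sends message `m` to node `v`. -/
abbrev Schedule (V M : Type) : Type := ℕ → V → V → Option M

/-- Node `v` holds message `m` after the first `t` rounds of the schedule `σ`,
if message `m` originates at node `src m`. -/
def Holds {V M : Type} (src : M → V) (σ : Schedule V M) : ℕ → V → M → Prop
  | 0, v, m => src m = v
  | t + 1, v, m => Holds src σ t v m ∨ ∃ u, σ t u v = some m

/-- Messages are only sent along edges of `G`, by nodes that hold them. -/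
def Schedule.IsValid {V M : Type} (G : SimpleGraph V) (src : M → V) (σ : Schedule V M) : Prop :=
  ∀ t u v m, σ t u v = some m → G.Adj u v ∧ Holds src σ t u m

/-- Within `β` rounds, a message `M_{v,w}` can be delivered from `v` to `w` for all pairs of
nodes `v, w`, all at the same time. -/
def IsCliqueEmulator {V : Type} (G : SimpleGraph V) (β : ℕ) : Prop :=
  ∃ σ : Schedule V (V × V), σ.IsValid G Prod.fst ∧ ∀ v w, Holds Prod.fst σ β w (v, w)

/-- Within `γ` rounds, the messages `M_v`, one originating at each `v ∈ S`, can all be delivered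
to some nodes of `T`. -/
def IsConvergecaster {V : Type} (G : SimpleGraph V) (S T : Set V) (γ : ℕ) : Prop :=
  ∃ σ : Schedule V S, σ.IsValid G Subtype.val ∧ ∀ m : S, ∃ w ∈ T, Holds Subtype.val σ γ w m

end Delivery

section CorePeriphery

/-- For each node of `S`, the number of neighbours outside `S`, divided by one plus the number of
neighbours inside `S`, is at most `α`. -/
def HasBalancedBoundary {V : Type} (G : SimpleGraph V) (S : Set V) (α : ℝ) : Prop :=
  ∀ v ∈ S, ((G.neighborSet v \ S).ncard : ℝ) / ((G.neighborSet v ∩ S).ncard + 1) ≤ α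

/-- The graph `G`, partitioned into the core `C` and the periphery `Cᶜ`, is a core-periphery
network with constants `α`, `β`, `γ` in its three axioms. -/
structure IsCorePeripheryNetwork {V : Type} (G : SimpleGraph V) (C : Set V)
    (α : ℝ) (β γ : ℕ) : Prop where
  coreBoundary : HasBalancedBoundary G C α
  cliqueEmulation : IsCliqueEmulator (G.induce C) β
  convergecast : IsConvergecaster G Cᶜ C γ

end CorePeriphery

/-! ### Randomized synchronous algorithms in the CONGEST model -/

section Congest

/-- The number of binary digits of `n`. -/
def bitLength (n : ℕ) : ℕ := Nat.log 2 n + 1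

/-- Messages of at most `w` bits; the empty string stands for sending nothing. -/
abbrev Message (w : ℕ) : Type := {l : List Bool // l.length ≤ w}

def Message.silent (w : ℕ) : Message w := ⟨[], Nat.zero_le w⟩

/-- A randomized distributed algorithm with node set `V`, messages of at most `w` bits, `r` private
random bits at each node, local inputs in `In` and local outputs in `Out`. The first argument of
each field is the node that executes the step, and all arguments are local to that node. -/
structure Protocol (V : Type) (w r : ℕ) (In Out : Type) where
  /-- local states -/
  State : Type
  /-- the initial state, from the local input and the private random bits -/
  start : V → In → (Fin r → Bool) → State
  /-- `send v x u` is the message that `v` in state `x` sends to its neighbour `u` -/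
  send : V → State → V → Message w
  /-- the new state, from the old one and the messages received from the other nodes -/
  update : V → State → (V → Message w) → State
  /-- the output, read off the current state -/
  output : V → State → Out

variable {V : Type} {w r : ℕ} {In Out : Type}

open Classical in
/-- The state of each node after `t` rounds on the network `G`. Only messages between adjacent
nodes are transmitted. -/
noncomputable def Protocol.stateAfter (P : Protocol V w r In Out) (G : SimpleGraph V)
    (input : V → In) (ω : V → Fin r → Bool) : ℕ → V → P.State
  | 0, v => P.start v (input v) (ω v)
  | t + 1, v => P.update v (P.stateAfter G input ω t v) fun u =>
      if G.Adj u v then P.send u (P.stateAfter G input ω t u) v else Message.silent w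

/-- The probability, over independent uniform private random bits, that after `T` rounds on `G`
every node `v` has the output `target v`. -/
noncomputable def Protocol.successProb (P : Protocol V w r In Out) (G : SimpleGraph V)
    (input : V → In) (target : V → Out) (T : ℕ) : ℝ :=
  ({ω : V → Fin r → Bool | ∀ v, P.output v (P.stateAfter G input ω T v) = target v}.ncard : ℝ) /
    (Nat.card (V → Fin r → Bool) : ℝ)

end Congest

section SparseMatrix

/-- Each row and each column has at most `m` nonzero entries. -/
def IsSparseMatrix {n : ℕ} {R : Type} [Zero R] (A : Matrix (Fin n) (Fin n) R) (m : ℕ) : Prop :=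
  (∀ i, {j | A i j ≠ 0}.ncard ≤ m) ∧ ∀ j, {i | A i j ≠ 0}.ncard ≤ m

end SparseMatrix

/-! The algorithm is deterministic, so it succeeds with probability 1. The core does the work: it
simulates a clique, and there sparse transposition becomes a routing problem with balanced loads.

The convergecast schedule assigns to each node a representative in the core, and the same schedule
run backwards returns data to the nodes. In `γ` rounds a core node receives at most `γ` messages per
edge, and the boundary axiom bounds its degree by `(1 + ⌈α⌉₊) * |C|`. So it represents only `O(|C|)`
nodes (`IsCorePeripheryNetwork.exists_representatives`) and has `O(k|C|)` nonzero entries to handle.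
An entry of column `j` must reach the owner of row `j`, which its holder does not know. A fixed core
node is therefore in charge of each column `j`; it receives both the entries of the column and the
name of the owner, and forwards the entries (`EmulatesClique.exists_reach_transpose`).

Routing (`EmulatesClique.exists_reach_route`) takes place in a clique of `q * q` virtual nodes, in
`q` groups of size `q`. This size lets all nodes of a group learn `q` numbers from each member in
two exchanges, so they can compute a common plan. A plan is an edge colouring of a bipartite
multigraph whose colours are the relay nodes. With `q * q` colours, a greedy choice uses each colour
at each vertex at most twice as often as the average bound (`exists_even_coloring`), so every link
carries few tokens. Inside a group the vertices are nodes. Between groups the vertices are whole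
groups, once each group has spread its tokens evenly over its members.

Instead of programs, the proof tracks which quantities are determined by the local view of each
node; `Reach.exists_protocol` turns such an argument into an actual protocol. -/

/-! ### Knowledge in synchronous networks -/

section Knowledge

variable {V Ω : Type} {w : ℕ} {G : SimpleGraph V}

/-- What the nodes know about the global input: `E v ω ω'` means that node `v` cannot tell the
inputs `ω` and `ω'` apart. -/
abbrev View (V Ω : Type) : Type := V → Ω → Ω → Prop

/-- The quantity `f` is determined by what is known. -/
def Knows {β : Type} (e : Ω → Ω → Prop) (f : Ω → β) : Prop :=
  ∀ ⦃ω ω'⦄, e ω ω' → f ω = f ω'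

theorem Knows.mono {β : Type} {e e' : Ω → Ω → Prop} {f : Ω → β} (hf : Knows e f) (h : e' ≤ e) :
    Knows e' f := fun _ _ hω => hf (h _ _ hω)

theorem Knows.comp {β δ : Type} {e : Ω → Ω → Prop} {f : Ω → β} (hf : Knows e f) (φ : β → δ) :
    Knows e fun ω => φ (f ω) := fun _ _ hω => congrArg φ (hf hω)

theorem Knows.comp₂ {β β' δ : Type} {e : Ω → Ω → Prop} {f : Ω → β} {g : Ω → β'}
    (hf : Knows e f) (hg : Knows e g) (φ : β → β' → δ) : Knows e fun ω => φ (f ω) (g ω) :=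
  fun _ _ hω => congrArg₂ φ (hf hω) (hg hω)

theorem Knows.pi {ι : Type} {β : ι → Type} {e : Ω → Ω → Prop} {f : Ω → (i : ι) → β i}
    (hf : ∀ i, Knows e fun ω => f ω i) : Knows e f := fun _ _ hω => funext fun i => hf i hω

theorem Knows.const {β : Type} {e : Ω → Ω → Prop} (b : β) : Knows e fun _ => b :=
  fun _ _ _ => rfl

/-- `Reach G w E T E'`: starting with the knowledge `E`, the nodes of the network `G` have the
knowledge `E'` after `T` rounds with messages of `w` bits. -/
inductive Reach (G : SimpleGraph V) (w : ℕ) (E : View V Ω) : ℕ → View V Ω → Prop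
  | refl : Reach G w E 0 E
  | round {T : ℕ} {E' : View V Ω} (m : Ω → V → V → Message w) (hr : Reach G w E T E')
      (hm : ∀ u v, Knows (E' u) fun ω => m ω u v) :
      Reach G w E (T + 1) fun v ω ω' => E' v ω ω' ∧ ∀ u, G.Adj u v → m ω u v = m ω' u v

theorem Reach.trans {E E' E'' : View V Ω} {T T' : ℕ} (h : Reach G w E T E')
    (h' : Reach G w E' T' E'') : Reach G w E (T + T') E'' := by
  induction h' with
  | refl => exact h
  | round m _ hm ih => exact Reach.round m ih hm

theorem Reach.le {E E' : View V Ω} {T : ℕ} (h : Reach G w E T E') : E' ≤ E := by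
  induction h with
  | refl => exact le_rfl
  | round m _ _ ih => exact fun v ω ω' hω => ih v ω ω' hω.1

theorem Reach.knows {β : Type} {E E' : View V Ω} {T : ℕ} (h : Reach G w E T E') {v : V}
    {f : Ω → β} (hf : Knows (E v) f) : Knows (E' v) f := hf.mono (h.le v)

theorem exists_reach_add (E : View V Ω) (T : ℕ) : ∃ E', Reach G w E T E' := by
  induction T with
  | zero => exact ⟨E, .refl⟩
  | succ T ih =>
    obtain ⟨E', h⟩ := ih
    exact ⟨_, .round (fun _ _ _ => Message.silent w) h fun _ _ => Knows.const _⟩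

theorem Reach.mono_time {E E' : View V Ω} {T T' : ℕ} (h : Reach G w E T E') (hT : T ≤ T') :
    ∃ E'', Reach G w E T' E'' ∧ E'' ≤ E' := by
  obtain ⟨E'', h'⟩ := exists_reach_add (G := G) (w := w) E' (T' - T)
  refine ⟨E'', ?_, h'.le⟩
  have := h.trans h'
  rwa [Nat.add_sub_cancel' hT] at this

/-- Tasks that take `T` rounds each are completed one after the other. -/
theorem Reach.sequence {T : ℕ} {E₀ : View V Ω} (Q : ℕ → View V Ω → Prop)
    (hQ : ∀ i E E', E' ≤ E → Q i E → Q i E') (x : ℕ)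
    (h : ∀ i < x, ∀ E ≤ E₀, ∃ E', Reach G w E T E' ∧ Q i E') :
    ∃ E', Reach G w E₀ (x * T) E' ∧ ∀ i < x, Q i E' := by
  induction x with
  | zero => exact ⟨E₀, by simpa using Reach.refl, by simp⟩
  | succ x ih =>
    obtain ⟨E₁, h₁, hq₁⟩ := ih fun i hi => h i (by omega)
    obtain ⟨E₂, h₂, hq₂⟩ := h x (by omega) E₁ h₁.le
    refine ⟨E₂, by rw [Nat.succ_mul]; exact h₁.trans h₂, fun i hi => ?_⟩
    rcases Nat.lt_succ_iff_lt_or_eq.1 hi with hi | rfl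
    · exact hQ _ _ _ h₂.le (hq₁ i hi)
    · exact hq₂

/-! ### From knowledge to protocols -/

/-- The knowledge after `t` rounds in which the messages `m` are sent. -/
def viewAfter (G : SimpleGraph V) (m : ℕ → Ω → V → V → Message w) (E : View V Ω) : ℕ → View V Ω
  | 0 => E
  | t + 1 => fun v ω ω' =>
      viewAfter G m E t v ω ω' ∧ ∀ u, G.Adj u v → m t ω u v = m t ω' u v

theorem viewAfter_congr {m m' : ℕ → Ω → V → V → Message w} (E : View V Ω) {T : ℕ}
    (h : ∀ t < T, m t = m' t) : viewAfter G m E T = viewAfter G m' E T := by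
  induction T with
  | zero => rfl
  | succ T ih =>
    rw [viewAfter, viewAfter, ih fun t ht => h t (by omega), h T (by omega)]

/-- Flattens the inductive derivation into a single message table indexed by rounds, which a
protocol can follow. -/
theorem Reach.exists_messages {E E' : View V Ω} {T : ℕ} (h : Reach G w E T E') :
    ∃ m : ℕ → Ω → V → V → Message w,
      (∀ t < T, ∀ u v, Knows (viewAfter G m E t u) fun ω => m t ω u v) ∧
        viewAfter G m E T = E' := by
  induction h with
  | refl => exact ⟨fun _ _ _ _ => Message.silent w, by simp, rfl⟩
  | @round T E' m' _ hm ih =>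
    obtain ⟨m, h₁, h₂⟩ := ih
    have key : ∀ t ≤ T, viewAfter G (Function.update m T m') E t = viewAfter G m E t :=
      fun t ht => viewAfter_congr E fun i hi => Function.update_of_ne (by omega) _ _
    refine ⟨Function.update m T m', fun t ht u v => ?_, ?_⟩
    · rw [key t (by omega)]
      rcases Nat.lt_succ_iff_lt_or_eq.1 ht with ht | rfl
      · rw [Function.update_of_ne (by omega)]
        exact h₁ t ht u v
      · rw [Function.update_self, h₂]
        exact hm u v
    · rw [viewAfter, key T le_rfl, Function.update_self, h₂]

open Classical in
/-- The protocol in which each node keeps track of the inputs it considers possible. -/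
noncomputable def knowledgeProtocol {In Out : Type} [Inhabited Out] (G : SimpleGraph V)
    (m : ℕ → Ω → V → V → Message w) (input : Ω → V → In) (target : Ω → V → Out) :
    Protocol V w 0 In Out where
  State := ℕ × Set Ω
  start v x _ := (0, {ω | x = input ω v})
  -- Any input still considered possible will do, because the message depends only on what `v`
  -- knows. The true input always remains possible, so the silent branch is never reached.
  send v x u := if h : x.2.Nonempty then m x.1 h.some v u else Message.silent w
  update v x μ := (x.1 + 1, {ω ∈ x.2 | ∀ u, G.Adj u v → μ u = m x.1 ω u v})
  output v x := if h : x.2.Nonempty then target h.some v else default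

theorem viewAfter_refl {m : ℕ → Ω → V → V → Message w} {E : View V Ω} (hE : ∀ v ω, E v ω ω)
    (T : ℕ) (v : V) (ω : Ω) : viewAfter G m E T v ω ω := by
  induction T with
  | zero => exact hE v ω
  | succ T ih => exact ⟨ih, fun _ _ => rfl⟩

theorem Reach.exists_protocol {In Out : Type} [Inhabited Out] {input : Ω → V → In}
    {target : Ω → V → Out} {T : ℕ} {E' : View V Ω}
    (h : Reach G w (fun v ω ω' => input ω v = input ω' v) T E')
    (ht : ∀ v, Knows (E' v) fun ω => target ω v) :
    ∃ P : Protocol V w 0 In Out, ∀ ω ρ v,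
      P.output v (P.stateAfter G (input ω) ρ T v) = target ω v := by
  obtain ⟨m, hm, rfl⟩ := h.exists_messages
  set E : View V Ω := fun v ω ω' => input ω v = input ω' v
  have hE : ∀ t v ω, viewAfter G m E t v ω ω := viewAfter_refl fun _ _ => rfl
  refine ⟨knowledgeProtocol G m input target, fun ω ρ v => ?_⟩
  have key : ∀ t ≤ T, ∀ v, (knowledgeProtocol G m input target).stateAfter G (input ω) ρ t v =
      (t, {ω' | viewAfter G m E t v ω ω'}) := by
    intro t
    induction t with
    | zero => intro _ v; rfl
    | succ t ih =>
      intro ht v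
      rw [Protocol.stateAfter, ih (by omega)]
      simp only [knowledgeProtocol, viewAfter, Prod.mk.injEq, true_and]
      ext ω'
      simp only [Set.mem_ofPred_eq]
      refine and_congr_right fun _ => forall_congr' fun u => forall_congr' fun hu => ?_
      rw [if_pos hu]
      have ihu := ih (by omega) u
      simp only [knowledgeProtocol] at ihu
      rw [ihu]
      have hne : ({ω' | viewAfter G m E t u ω ω'} : Set Ω).Nonempty := ⟨ω, hE t u ω⟩
      rw [dif_pos hne]
      -- The input picked by `u` is indistinguishable from `ω` for `u`, hence prescribes the same
      -- message.
      exact Eq.congr_left (hm t (by omega) u v hne.some_mem).symm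
  have := key T le_rfl v
  rw [this]
  have hne : ({ω' | viewAfter G m E T v ω ω'} : Set Ω).Nonempty := ⟨ω, hE T v ω⟩
  simp only [knowledgeProtocol]
  rw [dif_pos hne]
  exact (ht v hne.some_mem).symm

theorem successProb_eq_one {In Out : Type} [Finite V] {r : ℕ} (P : Protocol V w r In Out)
    (input : V → In) (target : V → Out) (T : ℕ)
    (h : ∀ ρ v, P.output v (P.stateAfter G input ρ T v) = target v) :
    P.successProb G input target T = 1 := by
  have : {ω : V → Fin r → Bool | ∀ v, P.output v (P.stateAfter G input ω T v) = target v} =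
      Set.univ := Set.eq_univ_of_forall h
  rw [Protocol.successProb, this, Set.ncard_univ]
  exact div_self (Nat.cast_ne_zero.2 Nat.card_pos.ne')

/-! ### Store-and-forward delivery -/

theorem exists_reach_edges (E : View V Ω) (D : Ω → V → V → Message w)
    (hD : ∀ u v, Knows (E u) fun ω => D ω u v) :
    ∃ E', Reach G w E 1 E' ∧ ∀ u v, G.Adj u v → Knows (E' v) fun ω => D ω u v :=
  ⟨_, .round D .refl hD, fun u _ huv _ _ hω => hω.2 u huv⟩

/-- A valid schedule makes every holder of a message know its content. -/
theorem exists_reach_delivery {W M : Type} {H : SimpleGraph W} (f : W ↪ V)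
    (hf : ∀ a b, H.Adj a b → G.Adj (f a) (f b)) {src : M → W} {σ : Schedule W M}
    (hσ : σ.IsValid H src) (E : View V Ω) (D : Ω → M → Message w)
    (hD : ∀ μ, Knows (E (f (src μ))) fun ω => D ω μ) (T : ℕ) :
    ∃ E', Reach G w E T E' ∧ ∀ v μ, Holds src σ T v μ → Knows (E' (f v)) fun ω => D ω μ := by
  classical
  induction T with
  | zero =>
    refine ⟨E, .refl, fun v μ h => ?_⟩
    obtain rfl : src μ = v := h
    exact hD μ
  | succ T ih =>
    obtain ⟨E₁, h₁, hk⟩ := ih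
    -- At most one `μ` qualifies, since `σ T a b` determines it and `f` is injective.
    let D' : Ω → V → V → Message w := fun ω u v =>
      if h : ∃ μ a b, σ T a b = some μ ∧ f a = u ∧ f b = v then D ω h.choose
      else Message.silent w
    obtain ⟨E₂, h₂, hk₂⟩ := exists_reach_edges (G := G) E₁ D' (by
      intro u v
      by_cases h : ∃ μ a b, σ T a b = some μ ∧ f a = u ∧ f b = v
      · simp only [D', dif_pos h]
        obtain ⟨a, b, hab, ha, hb⟩ := h.choose_spec
        exact ha ▸ hk a h.choose (hσ T a b _ hab).2
      · simp only [D', dif_neg h]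
        exact Knows.const _)
    refine ⟨E₂, h₁.trans h₂, fun v μ hv => ?_⟩
    rcases hv with hv | ⟨u, hu⟩
    · exact h₂.knows (hk v μ hv)
    · have h : ∃ μ a b, σ T a b = some μ ∧ f a = f u ∧ f b = f v := ⟨μ, u, v, hu, rfl, rfl⟩
      have hc : h.choose = μ := by
        obtain ⟨a, b, hab, ha, hb⟩ := h.choose_spec
        rw [f.injective ha, f.injective hb, hu] at hab
        exact (Option.some.inj hab).symm
      have := hk₂ (f u) (f v) (hf u v (hσ T u v μ hu).1)
      simp only [D', dif_pos h, hc] at this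
      exact this

/-- Running a valid schedule backwards takes messages from their holders to their origins. -/
theorem exists_reach_reverse_delivery {M : Type} {src : M → V} {σ : Schedule V M}
    (hσ : σ.IsValid G src) (D : Ω → M → Message w) (T : ℕ) (E : View V Ω) (hold : M → V)
    (hh : ∀ μ, Holds src σ T (hold μ) μ) (hD : ∀ μ, Knows (E (hold μ)) fun ω => D ω μ) :
    ∃ E', Reach G w E T E' ∧ ∀ μ, Knows (E' (src μ)) fun ω => D ω μ := by
  classical
  induction T generalizing E hold with
  | zero =>
    refine ⟨E, .refl, fun μ => ?_⟩
    rw [show src μ = hold μ from hh μ]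
    exact hD μ
  | succ T ih =>
    -- The last round of the schedule is undone first. A current holder `u` that got its message
    -- from `v` in that round sends it back; the edge carried only one message, so there is no
    -- conflict.
    let D' : Ω → V → V → Message w := fun ω u v =>
      if h : ∃ μ, σ T v u = some μ ∧ hold μ = u then D ω h.choose else Message.silent w
    obtain ⟨E₁, h₁, hk₁⟩ := exists_reach_edges (G := G) E D' (by
      intro u v
      by_cases h : ∃ μ, σ T v u = some μ ∧ hold μ = u
      · simp only [D', dif_pos h]
        have := hD h.choose
        rwa [h.choose_spec.2] at this
      · simp only [D', dif_neg h]
        exact Knows.const _)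
    have hstep : ∀ μ, ∃ u, Holds src σ T u μ ∧ Knows (E₁ u) fun ω => D ω μ := by
      intro μ
      rcases hh μ with h | ⟨u, hu⟩
      · exact ⟨_, h, h₁.knows (hD μ)⟩
      · refine ⟨u, (hσ T u _ μ hu).2, ?_⟩
        have h : ∃ μ', σ T u (hold μ) = some μ' ∧ hold μ' = hold μ := ⟨μ, hu, rfl⟩
        have hc : h.choose = μ := by
          have := h.choose_spec.1
          exact (Option.some.inj (hu.symm.trans this)).symm
        have := hk₁ (hold μ) u (hσ T u _ μ hu).1.symm
        simp only [D', dif_pos h, hc] at this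
        exact this
    choose hold' hh' hD' using hstep
    obtain ⟨E₂, h₂, hk₂⟩ := ih E₁ hold' hh' hD'
    exact ⟨E₂, by rw [Nat.add_comm]; exact h₁.trans h₂, hk₂⟩

end Knowledge

/-! ### Data that fit into a number of messages -/

section Fits

/-- The elements of `s` are encoded by `x` messages of `w` bits. -/
def Fits {β : Type} (w x : ℕ) (s : Set β) : Prop :=
  ∃ enc : β → ℕ → Message w, ∀ a ∈ s, ∀ b ∈ s, (∀ i < x, enc a i = enc b i) → a = b

variable {β δ : Type} {w x y : ℕ}

theorem Fits.mono {s t : Set β} (h : Fits w x t) (hst : s ⊆ t) (hxy : x ≤ y) : Fits w y s := by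
  obtain ⟨enc, he⟩ := h
  exact ⟨enc, fun a ha b hb hab => he a (hst ha) b (hst hb) fun i hi => hab i (by omega)⟩

theorem Fits.of_injOn {s : Set β} {t : Set δ} (h : Fits w x t) (f : β → δ)
    (hf : Set.MapsTo f s t) (hinj : Set.InjOn f s) : Fits w x s := by
  obtain ⟨enc, he⟩ := h
  exact ⟨fun a => enc (f a), fun a ha b hb hab => hinj ha hb (he _ (hf ha) _ (hf hb) hab)⟩

theorem Fits.prod {s : Set β} {t : Set δ} (hs : Fits w x s) (ht : Fits w y t) :
    Fits w (x + y) (s ×ˢ t) := by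
  obtain ⟨e₁, h₁⟩ := hs
  obtain ⟨e₂, h₂⟩ := ht
  refine ⟨fun p i => if i < x then e₁ p.1 i else e₂ p.2 (i - x), fun a ha b hb hab => ?_⟩
  refine Prod.ext (h₁ _ ha.1 _ hb.1 fun i hi => ?_) (h₂ _ ha.2 _ hb.2 fun i hi => ?_)
  · simpa [hi] using hab i (by omega)
  · simpa using hab (x + i) (by omega)

theorem Fits.pi {s : Set β} (hs : Fits w x s) (k : ℕ) :
    Fits w (k * x) {f : Fin k → β | ∀ i, f i ∈ s} := by
  induction k with
  | zero => exact ⟨fun _ _ => Message.silent w, fun a _ b _ _ => Subsingleton.elim a b⟩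
  | succ k ih =>
    rw [Nat.succ_mul]
    refine (ih.prod hs).of_injOn (fun f => (fun i => f i.castSucc, f (Fin.last k)))
      (fun f hf => ⟨fun i => hf _, hf _⟩) fun f _ g _ hfg => ?_
    funext i
    refine Fin.lastCases (congrArg Prod.snd hfg) (fun j => ?_) i
    exact congrFun (congrArg Prod.fst hfg) j

theorem Fits.of_ncard_le {s : Set β} (hs : s.Finite) (h : s.ncard ≤ 2 ^ w) : Fits w 1 s := by
  classical
  have hcard : Fintype.card (Fin w → Bool) = 2 ^ w := by simp
  have := hs.to_subtype
  have := Fintype.ofFinite s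
  have hle : Fintype.card s ≤ Fintype.card (Fin w → Bool) := by
    rwa [hcard, ← Nat.card_eq_fintype_card, Nat.card_coe_set_eq]
  obtain ⟨f⟩ := Function.Embedding.nonempty_of_card_le hle
  refine ⟨fun a _ => if ha : a ∈ s then ⟨List.ofFn (f ⟨a, ha⟩), by simp⟩ else Message.silent w,
    fun a ha b hb hab => ?_⟩
  have := hab 0 Nat.one_pos
  simp only [dif_pos ha, dif_pos hb, Subtype.mk.injEq] at this
  exact congrArg Subtype.val (f.injective (List.ofFn_injective this))

theorem Fits.of_ncard_le_pow {s : Set β} (hs : s.Finite) (h : s.ncard ≤ (2 ^ w) ^ x) :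
    Fits w x s := by
  classical
  have h₁ : Fits w 1 (Set.univ : Set (Fin (2 ^ w))) :=
    Fits.of_ncard_le Set.finite_univ (by simp [Set.ncard_univ])
  have h₂ := h₁.pi x
  rw [mul_one] at h₂
  have := hs.to_subtype
  have := Fintype.ofFinite s
  have hle : Fintype.card s ≤ Fintype.card (Fin x → Fin (2 ^ w)) := by
    rw [← Nat.card_eq_fintype_card, Nat.card_coe_set_eq]
    simpa using h
  obtain ⟨f⟩ := Function.Embedding.nonempty_of_card_le hle
  rcases s.eq_empty_or_nonempty with rfl | ⟨a₀, ha₀⟩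
  · exact ⟨fun _ _ => Message.silent w, by simp⟩
  refine h₂.of_injOn (fun a => if ha : a ∈ s then f ⟨a, ha⟩ else f ⟨a₀, ha₀⟩) (by simp [Set.MapsTo])
    fun a ha b hb hab => ?_
  simp only [dif_pos ha, dif_pos hb] at hab
  exact congrArg Subtype.val (f.injective hab)

/-- The set is listed and padded with `none` up to length `N`; this is why token types are required
to fit together with one extra value. -/
theorem Fits.finset {N : ℕ} (hβ : Fits w x (Set.univ : Set (Option β))) :
    Fits w (N * x) {F : Finset β | F.card ≤ N} := by
  refine (hβ.pi N).of_injOn (fun F i => F.toList[(i : ℕ)]?) (by simp [Set.MapsTo])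
    fun F hF F' hF' h => ?_
  have hl : F.toList = F'.toList := by
    apply List.ext_getElem?
    intro i
    by_cases hi : i < N
    · exact congrFun h ⟨i, hi⟩
    · have h1 : F.toList.length ≤ i := by rw [Finset.length_toList]; exact le_trans hF (by omega)
      have h2 : F'.toList.length ≤ i := by rw [Finset.length_toList]; exact le_trans hF' (by omega)
      rw [List.getElem?_eq_none h1, List.getElem?_eq_none h2]
  classical
  rw [← Finset.toList_toFinset F, ← Finset.toList_toFinset F', hl]

end Fits

/-! ### Balanced assignments -/

section Balancing

open Finset

variable {α ι Tok U : Type} [DecidableEq ι] [DecidableEq Tok] [DecidableEq U]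

/-- The position of `t` in an enumeration of `F`. -/
noncomputable def rank (F : Finset Tok) (t : Tok) : ℕ :=
  if h : t ∈ F then (F.equivFin ⟨t, h⟩ : ℕ) else 0

theorem rank_lt {F : Finset Tok} {t : Tok} (h : t ∈ F) : rank F t < F.card := by
  rw [rank, dif_pos h]
  exact Fin.is_lt _

theorem rank_injOn (F : Finset Tok) : Set.InjOn (rank F) F := by
  intro a ha b hb hab
  rw [mem_coe] at ha hb
  rw [rank, rank, dif_pos ha, dif_pos hb] at hab
  exact congrArg Subtype.val (F.equivFin.injective (Fin.ext hab))

/-- The position of `t` among the elements of `F` of the same kind. -/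
noncomputable def rankIn (κ : Tok → ι) (F : Finset Tok) (t : Tok) : ℕ :=
  rank (F.filter fun t' => κ t' = κ t) t

/-- Ranks identify the tokens of one kind with the parallel edges `0, 1, ...` of a multigraph. A
rule stated on edge numbers thus gives a rule on tokens, and counts for edges bound counts for
tokens. -/
theorem card_filter_rankIn_kind_le (κ : Tok → ι) (F : Finset Tok) (i : ι) (p : ℕ → Prop)
    [DecidablePred p] :
    (F.filter fun t => κ t = i ∧ p (rankIn κ F t)).card ≤
      ((range (F.filter fun t => κ t = i).card).filter p).card := by
  refine card_le_card_of_injOn (rankIn κ F) (fun t ht => ?_) fun a ha b hb hab => ?_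
  · simp only [coe_filter, Set.mem_ofPred_eq] at ht
    obtain ⟨ht, rfl, hp⟩ := ht
    simp only [coe_filter, mem_range, Set.mem_ofPred_eq]
    exact ⟨rank_lt (by simp [ht]), hp⟩
  · simp only [coe_filter, Set.mem_ofPred_eq] at ha hb
    obtain ⟨ha, rfl, -⟩ := ha
    rw [rankIn, rankIn, hb.2.1] at hab
    exact rank_injOn _ (by simp [ha]) (by simp [hb.1, hb.2.1]) hab

theorem card_filter_rankIn_le [Fintype ι] (κ : Tok → ι) (F : Finset Tok) (p : ι → ℕ → Prop)
    [∀ i, DecidablePred (p i)] :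
    (F.filter fun t => p (κ t) (rankIn κ F t)).card ≤
      ∑ i, ((range (F.filter fun t => κ t = i).card).filter (p i)).card := by
  rw [card_eq_sum_card_fiberwise (f := κ) (t := univ) (fun _ _ => mem_coe.2 (mem_univ _))]
  refine sum_le_sum fun i _ => le_trans (card_le_card fun t ht => ?_)
    (card_filter_rankIn_kind_le κ F i (p i))
  simp only [mem_filter] at ht ⊢
  obtain ⟨⟨ht, hp⟩, rfl⟩ := ht
  exact ⟨ht, rfl, hp⟩

theorem card_range_filter_mod_le (N q z : ℕ) :
    ((range N).filter fun r => r % q = z).card ≤ N / q + 1 := by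
  refine le_trans (card_le_card_of_injOn (t := range (N / q + 1)) (· / q) (fun r hr => ?_)
    fun a ha b hb hab => ?_) (card_range _).le
  · simp only [coe_filter, mem_range, Set.mem_ofPred_eq] at hr
    simp only [coe_range, Set.mem_Iio]
    exact Nat.lt_succ_of_le (Nat.div_le_div_right hr.1.le)
  · simp only [coe_filter, mem_range, Set.mem_ofPred_eq] at ha hb
    rw [← Nat.div_add_mod a q, ← Nat.div_add_mod b q, ha.2, hb.2, show a / q = b / q from hab]

theorem card_range_filter_mod_mul_le (N q z : ℕ) :
    ((range (N * q)).filter fun r => r % q = z).card ≤ N := by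
  refine le_trans (card_le_card_of_injOn (t := range N) (· / q) (fun r hr => ?_)
    fun a ha b hb hab => ?_) (card_range _).le
  · simp only [coe_filter, mem_range, Set.mem_ofPred_eq] at hr
    simp only [coe_range, Set.mem_Iio]
    exact Nat.div_lt_of_lt_mul (by rw [mul_comm]; exact hr.1)
  · simp only [coe_filter, mem_range, Set.mem_ofPred_eq] at ha hb
    rw [← Nat.div_add_mod a q, ← Nat.div_add_mod b q, ha.2, hb.2, show a / q = b / q from hab]

/-- The elements of a finite set can be distributed evenly. -/
theorem exists_even_map [Fintype U] [Nonempty U] [DecidableEq α] (E : Finset α) :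
    ∃ f : α → U, ∀ z, (E.filter fun e => f e = z).card ≤ E.card / Fintype.card U + 1 := by
  have hpos : 0 < Fintype.card U := Fintype.card_pos
  refine ⟨fun e => (Fintype.equivFin U).symm ⟨rank E e % _, Nat.mod_lt _ hpos⟩, fun z => ?_⟩
  refine le_trans (card_le_card_of_injOn (rank E) (fun e he => ?_)
    ((rank_injOn E).mono (coe_subset.2 (filter_subset _ _))))
    (card_range_filter_mod_le E.card (Fintype.card U) (Fintype.equivFin U z))
  simp only [coe_filter, mem_range, Set.mem_ofPred_eq, Equiv.symm_apply_eq] at he ⊢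
  exact ⟨rank_lt he.1, congrArg Fin.val he.2⟩

theorem card_filter_sigma {I : Type} [Fintype I] (c : I → ℕ) (p : (Σ _ : I, ℕ) → Prop) [DecidablePred p] :
    (((univ : Finset I).sigma fun i => range (c i)).filter p).card =
      ∑ i, ((range (c i)).filter fun r => p ⟨i, r⟩).card := by
  rw [← card_sigma]
  congr 1
  ext ⟨i, r⟩
  simp

theorem exists_even_slots {q : ℕ} [NeZero q] (c : ι → ℕ) [Fintype ι] :
    ∃ f : ι → ℕ → Fin q, ∀ y, ∑ i, ((range (c i)).filter fun r => f i r = y).card ≤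
      (∑ i, c i) / q + 1 := by
  obtain ⟨f, hf⟩ := exists_even_map (U := Fin q) ((univ : Finset ι).sigma fun i => range (c i))
  refine ⟨fun i r => f ⟨i, r⟩, fun y => ?_⟩
  have := hf y
  rw [card_filter_sigma] at this
  simpa using this

theorem card_filter_insert_update_le [DecidableEq α] {A : Type} [DecidableEq A] (s : α → A)
    (col : α → U) (N : ℕ) {e : α} {E : Finset α} (he : e ∉ E) {z : U}
    (h : ∀ a z, (E.filter fun e => s e = a ∧ col e = z).card ≤ N)
    (hz : (E.filter fun e' => s e' = s e ∧ col e' = z).card < N) (a : A) (z' : U) :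
    ((insert e E).filter fun e' => s e' = a ∧ Function.update col e z e' = z').card ≤ N := by
  have hE : (E.filter fun e' => s e' = a ∧ Function.update col e z e' = z') =
      E.filter fun e' => s e' = a ∧ col e' = z' := by
    refine filter_congr fun e' he' => ?_
    rw [Function.update_of_ne (ne_of_mem_of_not_mem he' he)]
  rw [filter_insert, hE, Function.update_self]
  split_ifs with hc
  · obtain ⟨rfl, rfl⟩ := hc
    exact (card_insert_le _ _).trans hz
  · exact h a z'

/-- The edges of a bipartite graph can be coloured greedily so that at each vertex the colours
are used evenly. -/
theorem exists_even_coloring {A B : Type} [DecidableEq A] [DecidableEq B] [Fintype U] [Nonempty U]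
    [DecidableEq α] (s : α → A) (t : α → B) (X : ℕ) (E : Finset α)
    (hs : ∀ a, (E.filter fun e => s e = a).card ≤ X * Fintype.card U)
    (ht : ∀ b, (E.filter fun e => t e = b).card ≤ X * Fintype.card U) :
    ∃ col : α → U, (∀ a z, (E.filter fun e => s e = a ∧ col e = z).card ≤ 2 * X) ∧
      ∀ b z, (E.filter fun e => t e = b ∧ col e = z).card ≤ 2 * X := by
  induction E using Finset.induction_on with
  | empty => exact ⟨fun _ => Classical.arbitrary U, by simp⟩
  | insert e E he ih =>
    have hmono : ∀ {C : Type} [DecidableEq C] (f : α → C) (c : C),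
        (E.filter fun e => f e = c).card ≤ ((insert e E).filter fun e => f e = c).card :=
      fun f c => card_le_card (filter_subset_filter _ (subset_insert _ _))
    obtain ⟨col, h₁, h₂⟩ := ih (fun a => (hmono s a).trans (hs a)) fun b => (hmono t b).trans (ht b)
    have hsum : ∀ {C : Type} [DecidableEq C] (f : α → C),
        ∑ z, (E.filter fun e' => f e' = f e ∧ col e' = z).card + 1 =
          ((insert e E).filter fun e' => f e' = f e).card := by
      intro C _ f
      rw [filter_insert, if_pos rfl, card_insert_of_notMem (by simp [he]),
        card_eq_sum_card_fiberwise (f := col) (t := univ) (fun _ _ => mem_coe.2 (mem_univ _))]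
      simp only [filter_filter]
    obtain ⟨z, hz₁, hz₂⟩ : ∃ z, (E.filter fun e' => s e' = s e ∧ col e' = z).card < 2 * X ∧
        (E.filter fun e' => t e' = t e ∧ col e' = z).card < 2 * X := by
      -- If every colour were exhausted at one of the two ends of `e`, there would be at least `2 *
      -- X * |U|` edges at these ends besides `e`, counted with multiplicity, but each end has fewer
      -- than `X * |U|` of them.
      by_contra! hcon
      have hle : ∀ z ∈ (univ : Finset U), 2 * X ≤
          (E.filter fun e' => s e' = s e ∧ col e' = z).card +
            (E.filter fun e' => t e' = t e ∧ col e' = z).card := fun z _ => by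
        have := hcon z
        omega
      have h := card_nsmul_le_sum _ _ _ hle
      rw [sum_add_distrib, smul_eq_mul, card_univ] at h
      have h₃ := (hsum s).trans_le (hs (s e))
      have h₄ := (hsum t).trans_le (ht (t e))
      have h₅ : Fintype.card U * (2 * X) = 2 * (X * Fintype.card U) := by ring
      omega
    exact ⟨Function.update col e z, card_filter_insert_update_le s col _ he h₁ hz₁,
      card_filter_insert_update_le t col _ he h₂ hz₂⟩

/-- Greedy colouring of the bipartite multigraph with `c a b` edges between `a` and `b`. -/
theorem exists_even_matrix_coloring [Fintype U] [Nonempty U] [Fintype ι] (X : ℕ) (c : ι → ι → ℕ)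
    (hs : ∀ a, ∑ b, c a b ≤ X * Fintype.card U) (ht : ∀ b, ∑ a, c a b ≤ X * Fintype.card U) :
    ∃ col : ι → ι → ℕ → U,
      (∀ a z, ∑ b, ((range (c a b)).filter fun r => col a b r = z).card ≤ 2 * X) ∧
        ∀ b z, ∑ a, ((range (c a b)).filter fun r => col a b r = z).card ≤ 2 * X := by
  have key₁ : ∀ a (p : ι × ι → ℕ → Prop) [∀ i, DecidablePred (p i)],
      ∑ i : ι × ι, ((range (c i.1 i.2)).filter fun r => i.1 = a ∧ p i r).card =
        ∑ b, ((range (c a b)).filter fun r => p (a, b) r).card := by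
    intro a p _
    rw [Fintype.sum_prod_type, Fintype.sum_eq_single a fun a' ha' => by simp [ha']]
    simp
  have key₂ : ∀ b (p : ι × ι → ℕ → Prop) [∀ i, DecidablePred (p i)],
      ∑ i : ι × ι, ((range (c i.1 i.2)).filter fun r => i.2 = b ∧ p i r).card =
        ∑ a, ((range (c a b)).filter fun r => p (a, b) r).card := by
    intro b p _
    rw [Fintype.sum_prod_type_right, Fintype.sum_eq_single b fun a' ha' => by simp [ha']]
    simp
  obtain ⟨col, h₁, h₂⟩ := exists_even_coloring (U := U) (fun e : Σ _ : ι × ι, ℕ => e.1.1)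
    (fun e => e.1.2) X (univ.sigma fun i => range (c i.1 i.2))
    (fun a => by
      rw [card_filter_sigma]
      have := key₁ a fun _ _ => True
      simp only [and_true, filter_true, card_range] at this
      exact this.trans_le (hs a))
    (fun b => by
      rw [card_filter_sigma]
      have := key₂ b fun _ _ => True
      simp only [and_true, filter_true, card_range] at this
      exact this.trans_le (ht b))
  refine ⟨fun a b r => col ⟨(a, b), r⟩, fun a z => ?_, fun b z => ?_⟩
  · have := h₁ a z
    rwa [card_filter_sigma, key₁ a fun i r => col ⟨i, r⟩ = z] at this
  · have := h₂ b z
    rwa [card_filter_sigma, key₂ b fun i r => col ⟨i, r⟩ = z] at this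

/-! ### Tokens moving between nodes -/

/-- The tokens at each node after every token `t` at `u` has moved to `tgt u t`. -/
def moved [Fintype U] (P : U → Finset Tok) (tgt : U → Tok → U) (u' : U) : Finset Tok :=
  univ.biUnion fun u => (P u).filter fun t => tgt u t = u'

theorem mem_moved [Fintype U] {P : U → Finset Tok} {tgt : U → Tok → U} {u' : U} {t : Tok} :
    t ∈ moved P tgt u' ↔ ∃ u, t ∈ P u ∧ tgt u t = u' := by
  simp [moved]

theorem card_filter_moved_le [Fintype U] (P : U → Finset Tok) (tgt : U → Tok → U) (u' : U)
    (p : Tok → Prop) [DecidablePred p] :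
    ((moved P tgt u').filter p).card ≤
      ∑ u, ((P u).filter fun t => tgt u t = u' ∧ p t).card := by
  rw [moved, filter_biUnion]
  simp only [filter_filter]
  exact card_biUnion_le

theorem sum_card_filter_moved_le [Fintype U] (P : U → Finset Tok) (tgt : U → Tok → U)
    (p : Tok → Prop) [DecidablePred p] :
    ∑ u, ((moved P tgt u).filter p).card ≤ ∑ u, ((P u).filter p).card := by
  refine (sum_le_sum fun u _ => card_filter_moved_le P tgt u p).trans ?_
  rw [sum_comm]
  refine (sum_le_sum fun u _ => ?_)
  rw [card_eq_sum_card_fiberwise (s := (P u).filter p) (f := tgt u) (t := univ)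
    (fun _ _ => mem_coe.2 (mem_univ _))]
  simp only [filter_filter, and_comm]
  exact le_rfl

end Balancing

/-! ### Routing in an emulated clique -/

section Routing

open Finset

variable {V Ω Tok : Type} {w τ x y : ℕ} {G : SimpleGraph V}

/-- For all `i` at the same time, a message can be brought from `a i` to `b i` in `T` rounds. -/
def Transfers (G : SimpleGraph V) (w T : ℕ) {ι : Type} (a b : ι → V) : Prop :=
  ∀ (Ω : Type) (E : View V Ω) (D : Ω → ι → Message w), (∀ i, Knows (E (a i)) fun ω => D ω i) →
    ∃ E', Reach G w E T E' ∧ ∀ i, Knows (E' (b i)) fun ω => D ω i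

/-- The code words are sent one after the other. No decoder is needed: an injective code determines
the datum, which is all that knowledge means. -/
theorem Transfers.exists_reach {ι β : Type} {a b : ι → V} (hG : Transfers G w τ a b) {s : Set β}
    (hs : Fits w x s) (E : View V Ω) (D : Ω → ι → β) (hD : ∀ ω i, D ω i ∈ s)
    (hk : ∀ i, Knows (E (a i)) fun ω => D ω i) :
    ∃ E', Reach G w E (x * τ) E' ∧ ∀ i, Knows (E' (b i)) fun ω => D ω i := by
  obtain ⟨enc, he⟩ := hs
  obtain ⟨E', hr, hE'⟩ := Reach.sequence (G := G) (w := w) (T := τ) (E₀ := E)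
    (fun l E => ∀ i, Knows (E (b i)) fun ω => enc (D ω i) l)
    (fun l E E' hle hq i => (hq i).mono (hle _)) x fun l _ E₁ hle =>
      hG Ω E₁ (fun ω i => enc (D ω i) l)
        fun i => ((hk i).mono (hle _)).comp fun d => enc d l
  exact ⟨E', hr, fun i ω ω' hω =>
    he _ (hD ω i) _ (hD ω' i) fun l hl => hE' l hl i hω⟩

/-- The nodes `h u` of `G` emulate a clique with node set `U`, each round of it in `τ` rounds. -/
def EmulatesClique (G : SimpleGraph V) (w τ : ℕ) {U : Type} (h : U → V) : Prop :=
  Transfers G w τ (fun p : U × U => h p.1) fun p => h p.2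

section Clique

variable {U : Type} {h : U → V}

theorem EmulatesClique.exists_reach_send (hG : EmulatesClique G w τ h) {β : Type} {s : Set β}
    (hs : Fits w x s) (E : View V Ω) (D : Ω → U → U → β) (hD : ∀ ω u u', D ω u u' ∈ s)
    (hk : ∀ u u', Knows (E (h u)) fun ω => D ω u u') :
    ∃ E', Reach G w E (x * τ) E' ∧ ∀ u u', Knows (E' (h u')) fun ω => D ω u u' := by
  obtain ⟨E', hr, hE'⟩ := Transfers.exists_reach hG hs E (fun ω p => D ω p.1 p.2)
    (fun ω p => hD ω _ _) fun p => hk _ _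
  exact ⟨E', hr, fun u u' => hE' (u, u')⟩

variable [Fintype U] [DecidableEq U] [DecidableEq Tok]

theorem EmulatesClique.exists_reach_moved (hG : EmulatesClique G w τ h)
    (hT : Fits w y (Set.univ : Set (Option Tok))) (E : View V Ω) (P : Ω → U → Finset Tok)
    (nxt : Ω → U → Tok → U) (hP : ∀ u, Knows (E (h u)) fun ω => P ω u)
    (hn : ∀ u, Knows (E (h u)) fun ω => nxt ω u)
    (hx : ∀ ω u u', ((P ω u).filter fun t => nxt ω u t = u').card ≤ x) :
    ∃ E', Reach G w E (x * y * τ) E' ∧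
      ∀ u', Knows (E' (h u')) fun ω => moved (P ω) (nxt ω) u' := by
  obtain ⟨E', hr, hE'⟩ := hG.exists_reach_send (Fits.finset (N := x) hT) E
    (fun ω u u' => (P ω u).filter fun t => nxt ω u t = u') hx
    fun u u' => (hP u).comp₂ (hn u) fun P n => P.filter fun t => n t = u'
  exact ⟨E', hr, fun u' ω ω' hω => biUnion_congr rfl fun u _ => hE' u u' hω⟩

/-- Tokens travel to their targets `tgt` through the intermediate nodes `mid`. -/
theorem EmulatesClique.exists_reach_moved_via [Nonempty U] (hG : EmulatesClique G w τ h)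
    (hT : Fits w y (Set.univ : Set (Option Tok))) (hU : Fits w 2 (Set.univ : Set U))
    (E : View V Ω) (P : Ω → U → Finset Tok) (mid tgt : Ω → U → Tok → U)
    (hP : ∀ u, Knows (E (h u)) fun ω => P ω u)
    (hm : ∀ u, Knows (E (h u)) fun ω => mid ω u) (ht : ∀ u, Knows (E (h u)) fun ω => tgt ω u)
    (hx : ∀ ω u z, ((P ω u).filter fun t => mid ω u t = z).card ≤ x)
    (hx' : ∀ ω u' z, ∑ u, ((P ω u).filter fun t => tgt ω u t = u' ∧ mid ω u t = z).card ≤ x) :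
    ∃ E', Reach G w E (2 * (x * (y + 2) * τ)) E' ∧
      ∀ u', Knows (E' (h u')) fun ω => moved (P ω) (tgt ω) u' := by
  -- Each token travels together with its target, which the relay could not compute itself; this
  -- costs two extra messages.
  have hT' : Fits w (y + 2) (Set.univ : Set (Option (Tok × U))) := by
    refine (hT.prod hU).of_injOn (fun o => (o.map Prod.fst, (o.map Prod.snd).getD
      (Classical.arbitrary U))) (by simp [Set.MapsTo]) ?_
    rintro (_ | ⟨t, u⟩) - (_ | ⟨t', u'⟩) - hab
    · rfl
    · simp at hab
    · simp at hab
    · simpa using hab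
  obtain ⟨E₁, hr₁, hk₁⟩ := hG.exists_reach_moved (x := x) hT' E
    (fun ω u => (P ω u).image fun t => (t, tgt ω u t)) (fun ω u (p : Tok × U) => mid ω u p.1)
    (fun u => (hP u).comp₂ (ht u) fun P n => P.image fun t => (t, n t))
    (fun u => (hm u).comp fun m (p : Tok × U) => m p.1) (fun ω u z => by
      rw [filter_image]
      exact card_image_le.trans (hx ω u z))
  obtain ⟨E₂, hr₂, hk₂⟩ := hG.exists_reach_moved (x := x) hT' E₁ _ (fun _ _ p => p.2) hk₁
    (fun u => Knows.const _) (fun ω z u' => by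
      refine (card_filter_moved_le _ _ _ _).trans (le_trans (sum_le_sum fun u _ => ?_) (hx' ω u' z))
      rw [filter_image]
      refine card_image_le.trans (card_le_card fun t => ?_)
      simp only [mem_filter]
      tauto)
  refine ⟨E₂, by rw [two_mul]; exact hr₁.trans hr₂, fun u' => ?_⟩
  convert (hk₂ u').comp (fun F => F.image Prod.fst) using 2 with ω
  ext t
  simp only [mem_moved, mem_image, Prod.exists, Prod.mk.injEq]
  constructor
  · rintro ⟨u, hu, rfl⟩
    exact ⟨t, _, ⟨mid ω u t, ⟨u, ⟨t, hu, rfl, rfl⟩, rfl⟩, rfl⟩, rfl⟩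
  · rintro ⟨_, _, ⟨z, ⟨u, ⟨t, hu, rfl, rfl⟩, -⟩, rfl⟩, rfl⟩
    exact ⟨u, hu, rfl⟩

end Clique

/-- The counts `0, ..., |Tok|` are exactly as many as the elements of `Option Tok`, so a token count
costs no more than a token. -/
theorem fits_le_card [Fintype Tok] (hT : Fits w y (Set.univ : Set (Option Tok))) :
    Fits w y {N | N ≤ Fintype.card Tok} := by
  refine hT.of_injOn (fun N => if hN : N < Fintype.card Tok then
    some ((Fintype.equivFin Tok).symm ⟨N, hN⟩) else none) (by simp [Set.MapsTo]) ?_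
  intro a ha b hb hab
  simp only [Set.mem_ofPred_eq] at ha hb
  by_cases h₁ : a < Fintype.card Tok <;> by_cases h₂ : b < Fintype.card Tok <;>
    simp [h₁, h₂] at hab <;> omega

/-! The emulated clique is now divided into `q` groups of `q` nodes. -/

variable {q : ℕ} {h : Fin q × Fin q → V}

/-- Each node makes its `q` numbers known to all nodes of its group. -/
theorem EmulatesClique.exists_reach_group (hG : EmulatesClique G w τ h) {β : Type} {s : Set β}
    (hs : Fits w x s) (E : View V Ω) (f : Ω → Fin q → Fin q → Fin q → β)
    (hf : ∀ ω g a j, f ω g a j ∈ s) (hk : ∀ g a j, Knows (E (h (g, a))) fun ω => f ω g a j) :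
    ∃ E', Reach G w E (2 * (x * τ)) E' ∧ ∀ g a, Knows (E' (h (g, a))) fun ω => f ω g := by
  -- Relay `(a, j)` collects the `j`-th number of the `a`-th node of every group, then passes to
  -- each group the number that belongs to it.
  obtain ⟨E₁, hr₁, hk₁⟩ := hG.exists_reach_send hs E (fun ω u z => f ω u.1 u.2 z.2)
    (fun _ _ _ => hf _ _ _ _) fun u z => hk _ _ _
  obtain ⟨E₂, hr₂, hk₂⟩ := hG.exists_reach_send hs E₁ (fun ω z u => f ω u.1 z.1 z.2)
    (fun _ _ _ => hf _ _ _ _) fun z u => hk₁ (u.1, z.1) z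
  exact ⟨E₂, by rw [two_mul]; exact hr₁.trans hr₂, fun g y =>
    .pi fun a => .pi fun j => hk₂ (a, j) (g, y)⟩

theorem sum_group_eq {g : Fin q} {F : Fin q × Fin q → ℕ} (hF : ∀ u, u.1 ≠ g → F u = 0) :
    ∑ u, F u = ∑ a, F (g, a) := by
  rw [Fintype.sum_prod_type, Fintype.sum_eq_single g]
  exact fun g' hg' => sum_eq_zero fun a _ => hF _ hg'

variable [Fintype Tok] [DecidableEq Tok] [NeZero q]

/-- Tokens move within their groups. -/
theorem EmulatesClique.exists_reach_moved_in_groups (hG : EmulatesClique G w τ h)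
    (hT : Fits w y (Set.univ : Set (Option Tok)))
    (hU : Fits w 2 (Set.univ : Set (Fin q × Fin q))) (E : View V Ω)
    (P : Ω → Fin q × Fin q → Finset Tok) (tgt : Ω → Fin q × Fin q → Tok → Fin q × Fin q)
    (hP : ∀ u, Knows (E (h u)) fun ω => P ω u) (ht : ∀ u, Knows (E (h u)) fun ω => tgt ω u)
    (hgrp : ∀ ω u, ∀ t ∈ P ω u, (tgt ω u t).1 = u.1) (X : ℕ)
    (hX : ∀ ω u, (P ω u).card ≤ X * (q * q))
    (hX' : ∀ ω u', ∑ u, ((P ω u).filter fun t => tgt ω u t = u').card ≤ X * (q * q)) :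
    ∃ E', Reach G w E ((4 * X + 2) * (y + 2) * τ) E' ∧
      ∀ u', Knows (E' (h u')) fun ω => moved (P ω) (tgt ω) u' := by
  have hcard : Fintype.card (Fin q × Fin q) = q * q := by simp
  choose! col hcol₁ hcol₂ using
    exists_even_matrix_coloring (U := Fin q × Fin q) (ι := Fin q) X
  let n : Ω → Fin q → Fin q → Fin q → ℕ := fun ω g a b =>
    ((P ω (g, a)).filter fun t => (tgt ω (g, a) t).2 = b).card
  obtain ⟨E₁, hr₁, hk₁⟩ := hG.exists_reach_group (fits_le_card hT) E n
    (fun ω g a b => card_le_univ _)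
    fun g a b => (hP _).comp₂ (ht _) fun P f => (P.filter fun t => (f t).2 = b).card
  -- All nodes of a group know the same demand matrix `n` and hence use the same colouring without
  -- further communication; the colour of a token is its relay.
  let mid : Ω → Fin q × Fin q → Tok → Fin q × Fin q := fun ω u t =>
    col (n ω u.1) u.2 (tgt ω u t).2 (rankIn (fun t => (tgt ω u t).2) (P ω u) t)
  have hmid : ∀ u, Knows (E₁ (h u)) fun ω => mid ω u := fun u ω ω' hω => by
    have e₁ : n ω u.1 = n ω' u.1 := hk₁ u.1 u.2 hω
    have e₂ : P ω u = P ω' u := hr₁.knows (hP u) hω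
    have e₃ : tgt ω u = tgt ω' u := hr₁.knows (ht u) hω
    simp only [mid, e₁, e₂, e₃]
  have hrow : ∀ ω g a, ∑ b, n ω g a b ≤ X * Fintype.card (Fin q × Fin q) := fun ω g a => by
    rw [hcard]
    refine le_trans (le_of_eq ?_) (hX ω (g, a))
    exact (card_eq_sum_card_fiberwise fun _ _ => mem_coe.2 (mem_univ _)).symm
  have hin : ∀ ω g a b (t : Tok), t ∈ P ω (g, a) →
      (tgt ω (g, a) t = (g, b) ↔ (tgt ω (g, a) t).2 = b) := fun ω g a b t htP => by
    rw [Prod.ext_iff]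
    exact and_iff_right (hgrp ω (g, a) t htP)
  have hout : ∀ ω u g b (t : Tok), u.1 ≠ g → t ∈ P ω u → tgt ω u t ≠ (g, b) :=
    fun ω u g b t hu htP he => hu (by rw [← hgrp ω u t htP, he])
  have hcolumn : ∀ ω g b, ∑ a, n ω g a b ≤ X * Fintype.card (Fin q × Fin q) := fun ω g b => by
    rw [hcard]
    refine le_trans (le_of_eq ?_) (hX' ω (g, b))
    rw [sum_group_eq (g := g)]
    · exact sum_congr rfl fun a _ => congrArg card (filter_congr fun t htP => (hin ω g a b t htP).symm)
    · exact fun u hu => card_eq_zero.2 (filter_eq_empty_iff.2 fun t htP => hout ω u g b t hu htP)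
  obtain ⟨E₂, hr₂, hk₂⟩ := hG.exists_reach_moved_via (x := 2 * X) hT hU E₁ P mid tgt
    (fun u => hr₁.knows (hP u)) hmid (fun u => hr₁.knows (ht u))
    (fun ω u z => (card_filter_rankIn_le (fun t => (tgt ω u t).2) (P ω u)
      fun b r => col (n ω u.1) u.2 b r = z).trans
        (hcol₁ (n ω u.1) (hrow ω u.1) (hcolumn ω u.1) u.2 z))
    (fun ω ⟨g, b⟩ z => by
      rw [sum_group_eq (g := g)]
      · refine le_trans (sum_le_sum fun a _ => ?_)
          (hcol₂ (n ω g) (hrow ω g) (hcolumn ω g) b z)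
        refine le_trans (card_le_card fun t htP => ?_) (card_filter_rankIn_kind_le
          (fun t => (tgt ω (g, a) t).2) (P ω (g, a)) b fun r => col (n ω g) a b r = z)
        simp only [mem_filter] at htP ⊢
        obtain ⟨htP, h₁, h₂⟩ := htP
        have h₃ := (hin ω g a b t htP).1 h₁
        refine ⟨htP, h₃, ?_⟩
        simpa only [mid, h₃] using h₂
      · refine fun u hu => card_eq_zero.2 (filter_eq_empty_iff.2 fun t htP hc => ?_)
        exact hout ω u g b t hu htP hc.1)
  have htime : 2 * (y * τ) + 2 * (2 * X * (y + 2) * τ) ≤ (4 * X + 2) * (y + 2) * τ := by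
    have : (4 * X + 2) * (y + 2) * τ = 2 * (y * τ) + 2 * (2 * X * (y + 2) * τ) + 4 * τ := by ring
    omega
  obtain ⟨E₃, hr₃, hle⟩ := (hr₁.trans hr₂).mono_time htime
  exact ⟨E₃, hr₃, fun u' => (hk₂ u').mono (hle _)⟩

end Routing

/-! ### Routing between groups in the emulated clique -/

section Routing

open Finset

variable {V Ω Tok : Type} {w τ x y : ℕ} {G : SimpleGraph V}

variable {q : ℕ} {h : Fin q × Fin q → V} [NeZero q]

/-- The number of tokens that `(g, a)` has for destinations in group `g'`. -/
def groupDemand (dst : Tok → Fin q × Fin q) (P : Fin q × Fin q → Finset Tok) (g a g' : Fin q) :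
    ℕ :=
  ((P (g, a)).filter fun t => (dst t).1 = g').card

/-- The fair share in the tokens from group `g` to group `g'`. -/
def fairShare (dst : Tok → Fin q × Fin q) (P : Fin q × Fin q → Finset Tok) (g g' : Fin q) : ℕ :=
  (∑ a, groupDemand dst P g a g') / q + 1

/-- Rounding up adds `q` in total, which one more multiple of `q * q` absorbs; hence `B + 1`. -/
theorem sum_div_add_one_le {c : Fin q → ℕ} {B : ℕ} (hc : ∑ i, c i ≤ q * (B * (q * q))) :
    ∑ i, (c i / q + 1) ≤ (B + 1) * (q * q) := by
  have hq : 0 < q := Nat.pos_of_ne_zero (NeZero.ne q)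
  have h₁ : q * ∑ i, c i / q ≤ q * (B * (q * q)) := by
    rw [mul_sum]
    exact (sum_le_sum fun i _ => Nat.mul_div_le _ _).trans hc
  have h₂ := Nat.le_of_mul_le_mul_left h₁ hq
  have h₃ : q ≤ q * q := Nat.le_mul_of_pos_left q hq
  rw [sum_add_distrib, sum_const, card_univ, Fintype.card_fin, smul_eq_mul, mul_one, add_mul]
  omega

theorem sum_fairShare_le (dst : Tok → Fin q × Fin q) (P : Fin q × Fin q → Finset Tok) {B : ℕ}
    (hB : ∀ u, (P u).card ≤ B * (q * q)) (g : Fin q) :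
    ∑ g', fairShare dst P g g' ≤ (B + 1) * (q * q) := by
  refine sum_div_add_one_le ?_
  rw [sum_comm]
  refine (sum_le_card_nsmul _ _ (B * (q * q)) fun a _ => ?_).trans (by simp)
  refine le_trans (le_of_eq ?_) (hB (g, a))
  exact (card_eq_sum_card_fiberwise fun _ _ => mem_coe.2 (mem_univ _)).symm

theorem sum_fairShare_le' (dst : Tok → Fin q × Fin q) (P : Fin q × Fin q → Finset Tok) {B : ℕ}
    (hB : ∀ d, ∑ u, ((P u).filter fun t => dst t = d).card ≤ B * (q * q)) (g' : Fin q) :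
    ∑ g, fairShare dst P g g' ≤ (B + 1) * (q * q) := by
  refine sum_div_add_one_le ?_
  have key : ∑ g, ∑ a, groupDemand dst P g a g' =
      ∑ b, ∑ u, ((P u).filter fun t => dst t = (g', b)).card := by
    rw [sum_comm (s := univ) (t := univ) (f := fun b u => ((P u).filter fun t => dst t = (g', b)).card),
      Fintype.sum_prod_type]
    refine sum_congr rfl fun g _ => sum_congr rfl fun a _ => ?_
    rw [groupDemand, card_eq_sum_card_fiberwise (f := fun t => (dst t).2) (t := univ)
      (fun _ _ => mem_coe.2 (mem_univ _))]
    simp only [filter_filter, Prod.ext_iff]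
  rw [key]
  exact (sum_le_card_nsmul _ _ (B * (q * q)) fun b _ => hB (g', b)).trans (by simp)

variable [DecidableEq Tok]

/-- Moves neither lose nor create tokens, so the intermediate stages disappear from the description
of the final distribution. -/
theorem exists_mem_moved {U : Type} [Fintype U] [DecidableEq U] {P : U → Finset Tok}
    {tgt : U → Tok → U} {t : Tok} : (∃ u, t ∈ moved P tgt u) ↔ ∃ u, t ∈ P u := by
  simp [mem_moved]

variable [Fintype Tok]

/-- The tokens are distributed within each group so that all nodes of the group have equally many
tokens for each group of destinations, and these numbers become known to all nodes. -/
theorem EmulatesClique.exists_reach_balanced (hG : EmulatesClique G w τ h)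
    (hT : Fits w y (Set.univ : Set (Option Tok)))
    (hU : Fits w 2 (Set.univ : Set (Fin q × Fin q))) (E : View V Ω)
    (P : Ω → Fin q × Fin q → Finset Tok) (dst : Tok → Fin q × Fin q)
    (hP : ∀ u, Knows (E (h u)) fun ω => P ω u) (B : ℕ)
    (hB : ∀ ω u, (P ω u).card ≤ B * (q * q)) :
    ∃ (E' : View V Ω) (tgt : Ω → Fin q × Fin q → Tok → Fin q × Fin q),
      Reach G w E (3 * (y * τ) + (4 * (B + 1) + 2) * (y + 2) * τ) E' ∧
      (∀ u', Knows (E' (h u')) fun ω => moved (P ω) (tgt ω) u') ∧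
      (∀ u, Knows (E' (h u)) fun ω => fairShare dst (P ω)) ∧
      ∀ ω g y g', ((moved (P ω) (tgt ω) (g, y)).filter fun t => (dst t).1 = g').card ≤
        fairShare dst (P ω) g g' := by
  choose slot hslot using exists_even_slots (q := q) (ι := Fin q)
  obtain ⟨E₁, hr₁, hk₁⟩ := hG.exists_reach_group (fits_le_card hT) E
    (fun ω g a g' => groupDemand dst (P ω) g a g') (fun ω g a b => card_le_univ _)
    fun g a g' => (hP _).comp fun P => (P.filter fun t => (dst t).1 = g').card
  -- The slots deal out the tokens of group `u.1` for each destination group evenly among the `q`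
  -- members.
  let tgt : Ω → Fin q × Fin q → Tok → Fin q × Fin q := fun ω u t =>
    (u.1, slot (fun a => groupDemand dst (P ω) u.1 a (dst t).1) u.2
      (rankIn (fun t => (dst t).1) (P ω u) t))
  have htgt : ∀ u, Knows (E₁ (h u)) fun ω => tgt ω u := fun u ω ω' hω => by
    have e₁ : (fun a g' => groupDemand dst (P ω) u.1 a g') =
      fun a g' => groupDemand dst (P ω') u.1 a g' := hk₁ u.1 u.2 hω
    have e₂ : P ω u = P ω' u := hr₁.knows (hP u) hω
    have e₃ : ∀ a g', groupDemand dst (P ω) u.1 a g' = groupDemand dst (P ω') u.1 a g' :=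
      fun a g' => congrFun (congrFun e₁ a) g'
    simp only [tgt, e₂, e₃]
  have heven : ∀ ω g b g', ∑ u, ((P ω u).filter fun t =>
      tgt ω u t = (g, b) ∧ (dst t).1 = g').card ≤ fairShare dst (P ω) g g' := by
    intro ω g b g'
    rw [sum_group_eq (g := g)]
    · refine le_trans (sum_le_sum fun a _ => ?_)
        (hslot (fun a => groupDemand dst (P ω) g a g') b)
      refine le_trans (card_le_card fun t ht => ?_) (card_filter_rankIn_kind_le
        (fun t => (dst t).1) (P ω (g, a)) g' fun r =>
          slot (fun a => groupDemand dst (P ω) g a g') a r = b)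
      simp only [mem_filter, tgt, Prod.mk.injEq, true_and] at ht ⊢
      obtain ⟨ht, h₁, h₂⟩ := ht
      rw [h₂] at h₁
      exact ⟨ht, h₂, h₁⟩
    · exact fun u hu => card_eq_zero.2 (filter_eq_empty_iff.2 fun t ht hc =>
        hu (congrArg Prod.fst hc.1))
  obtain ⟨E₂, hr₂, hk₂⟩ := hG.exists_reach_moved_in_groups hT hU E₁ P tgt
    (fun u => hr₁.knows (hP u)) htgt (fun _ _ _ _ => rfl) (B + 1)
    (fun ω u => (hB ω u).trans (Nat.mul_le_mul_right _ (Nat.le_succ B)))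
    (fun ω ⟨g, b⟩ => by
      refine le_trans ?_ (sum_fairShare_le dst (P ω) (hB ω) g)
      refine le_trans (le_of_eq ?_) (sum_le_sum fun g' _ => heven ω g b g')
      rw [sum_comm]
      refine sum_congr rfl fun u _ => ?_
      rw [card_eq_sum_card_fiberwise (f := fun t => (dst t).1) (t := univ)
        (fun _ _ => mem_coe.2 (mem_univ _))]
      simp only [filter_filter])
  -- Node `(g, g')` announces the quotient for this pair of groups to everyone; there are exactly as
  -- many nodes as pairs.
  obtain ⟨E₃, hr₃, hk₃⟩ := hG.exists_reach_send (fits_le_card hT) E₂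
    (fun ω u _ => (∑ a, groupDemand dst (P ω) u.1 a u.2) / q)
    (fun ω u _ => by
      refine Nat.div_le_of_le_mul ?_
      refine (sum_le_card_nsmul _ _ (Fintype.card Tok) fun a _ => card_le_univ _).trans (by simp))
    (fun u _ => (hr₂.knows (hk₁ u.1 u.2)).comp fun f => (∑ a, f a u.2) / q)
  refine ⟨E₃, tgt, ?_, fun u' => hr₃.knows (hk₂ u'), fun u => .pi fun g => .pi fun g' =>
    (hk₃ (g, g') u).comp (· + 1), fun ω g b g' =>
      (card_filter_moved_le _ _ _ _).trans (heven ω g b g')⟩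
  have := (hr₁.trans hr₂).trans hr₃
  rwa [show 2 * (y * τ) + (4 * (B + 1) + 2) * (y + 2) * τ + y * τ =
    3 * (y * τ) + (4 * (B + 1) + 2) * (y + 2) * τ by ring] at this

/-- Each node receives all tokens destined for it, if every node is source and destination of at
most `B * q ^ 2` tokens. -/
theorem EmulatesClique.exists_reach_route (hG : EmulatesClique G w τ h)
    (hT : Fits w y (Set.univ : Set (Option Tok)))
    (hU : Fits w 2 (Set.univ : Set (Fin q × Fin q))) (E : View V Ω)
    (P : Ω → Fin q × Fin q → Finset Tok) (dst : Tok → Fin q × Fin q)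
    (hP : ∀ u, Knows (E (h u)) fun ω => P ω u) (B : ℕ)
    (hB : ∀ ω u, (P ω u).card ≤ B * (q * q))
    (hB' : ∀ ω d, ∑ u, ((P ω u).filter fun t => dst t = d).card ≤ B * (q * q)) :
    ∃ E', Reach G w E (23 * (B + 1) * (y + 2) * τ) E' ∧
      ∀ d, Knows (E' (h d)) fun ω => moved (P ω) (fun _ => dst) d := by
  have hcard : Fintype.card (Fin q × Fin q) = q * q := by simp
  obtain ⟨E₁, tgt, hr₁, hk₁, hshare, hle⟩ := hG.exists_reach_balanced hT hU E P dst hP B hB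
  choose! col hcol₁ hcol₂ using
    exists_even_matrix_coloring (U := Fin q × Fin q) (ι := Fin q) (B + 1)
  rw [hcard] at hcol₁ hcol₂
  have hrow := fun ω => sum_fairShare_le dst (P ω) (hB ω)
  have hcolumn := fun ω => sum_fairShare_le' dst (P ω) (hB' ω)
  set κ : Tok → Fin q := fun t => (dst t).1
  set P₁ : Ω → Fin q × Fin q → Finset Tok := fun ω => moved (P ω) (tgt ω)
  -- The coloured multigraph has the groups as vertices and the fair shares as multiplicities. All
  -- members of a group use the same colouring, each for its own tokens.
  let nxt₁ : Ω → Fin q × Fin q → Tok → Fin q × Fin q := fun ω u t =>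
    col (fairShare dst (P ω)) u.1 (κ t) (rankIn κ (P₁ ω u) t)
  obtain ⟨E₂, hr₂, hk₂⟩ := hG.exists_reach_moved (x := 2 * (B + 1)) hT E₁ P₁ nxt₁ hk₁
    (fun u ω ω' hω => by
      have e₁ : P₁ ω u = P₁ ω' u := hk₁ u hω
      have e₂ : fairShare dst (P ω) = fairShare dst (P ω') := hshare u hω
      simp only [nxt₁, e₁, e₂])
    (fun ω u z => by
      refine (card_filter_rankIn_le κ (P₁ ω u)
        fun g' r => col (fairShare dst (P ω)) u.1 g' r = z).trans
        (le_trans (sum_le_sum fun g' _ => card_le_card (filter_subset_filter _ ?_))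
          (hcol₁ _ (hrow ω) (hcolumn ω) u.1 z))
      exact range_subset_range.2 (hle ω u.1 u.2 g'))
  set P₂ : Ω → Fin q × Fin q → Finset Tok := fun ω => moved (P₁ ω) (nxt₁ ω)
  -- For each position `b`, the nodes `(g, b)` together send at most `2 * (B + 1)` tokens for `g'`
  -- to `z`, by the colouring at `g'`; there are `q` positions.
  have hP₂ : ∀ ω z g', ((P₂ ω z).filter fun t => κ t = g').card ≤ 2 * (B + 1) * q := by
    intro ω z g'
    refine (card_filter_moved_le _ _ _ _).trans ?_
    rw [Fintype.sum_prod_type, sum_comm]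
    refine (sum_le_card_nsmul _ _ (2 * (B + 1)) fun b _ => ?_).trans (by simp [mul_comm])
    refine le_trans (sum_le_sum fun g _ => ?_) (hcol₂ _ (hrow ω) (hcolumn ω) g' z)
    refine le_trans (card_le_card fun t ht => ?_) ((card_filter_rankIn_kind_le κ (P₁ ω (g, b)) g'
      fun r => col (fairShare dst (P ω)) g g' r = z).trans
        (card_le_card (filter_subset_filter _ (range_subset_range.2 (hle ω g b g')))))
    simp only [mem_filter, nxt₁] at ht ⊢
    obtain ⟨ht, h₁, h₂⟩ := ht
    rw [h₂] at h₁
    exact ⟨ht, h₂, h₁⟩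
  -- Each relay deals its tokens for a group round-robin to the `q` members; only moves inside
  -- groups then remain.
  let nxt₂ : Ω → Fin q × Fin q → Tok → Fin q × Fin q := fun ω z t =>
    (κ t, Fin.ofNat q (rankIn κ (P₂ ω z) t))
  have hload : ∀ ω z u', ((P₂ ω z).filter fun t => nxt₂ ω z t = u').card ≤ 2 * (B + 1) := by
    intro ω z u'
    refine le_trans (card_le_card fun t ht => ?_) ((card_filter_rankIn_kind_le κ (P₂ ω z) u'.1
      fun r => r % q = u'.2).trans ((card_le_card (filter_subset_filter _
        (range_subset_range.2 (hP₂ ω z u'.1)))).trans (card_range_filter_mod_mul_le _ _ _)))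
    simp only [mem_filter, nxt₂, Prod.ext_iff, Fin.ext_iff, Fin.val_ofNat] at ht ⊢
    exact ht
  obtain ⟨E₃, hr₃, hk₃⟩ := hG.exists_reach_moved hT E₂ P₂ nxt₂ hk₂
    (fun u => (hk₂ u).comp fun F t => (κ t, Fin.ofNat q (rankIn κ F t))) hload
  obtain ⟨E₄, hr₄, hk₄⟩ := hG.exists_reach_moved_in_groups hT hU E₃
    (fun ω => moved (P₂ ω) (nxt₂ ω)) (fun _ _ => dst) hk₃ (fun _ => Knows.const _)
    (fun ω u t ht => by
      obtain ⟨z, -, rfl⟩ := mem_moved.1 ht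
      rfl)
    (2 * (B + 1))
    (fun ω u => by
      refine card_biUnion_le.trans
        ((sum_le_card_nsmul _ _ (2 * (B + 1)) fun z _ => hload ω z u).trans ?_)
      rw [card_univ, hcard, smul_eq_mul, mul_comm])
    (fun ω d => by
      refine (sum_card_filter_moved_le _ _ _).trans ((sum_card_filter_moved_le _ _ _).trans
        ((sum_card_filter_moved_le _ _ _).trans ((hB' ω d).trans ?_)))
      exact Nat.mul_le_mul_right _ (by omega))
  have htime : 3 * (y * τ) + (4 * (B + 1) + 2) * (y + 2) * τ + 2 * (B + 1) * y * τ +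
      2 * (B + 1) * y * τ + (4 * (2 * (B + 1)) + 2) * (y + 2) * τ ≤
        23 * (B + 1) * (y + 2) * τ := by
    have : 23 * (B + 1) * (y + 2) * τ = 3 * (y * τ) + (4 * (B + 1) + 2) * (y + 2) * τ +
      2 * (B + 1) * y * τ + 2 * (B + 1) * y * τ + (4 * (2 * (B + 1)) + 2) * (y + 2) * τ +
        (7 * B * (y + 2) * τ + 6 * τ + 8 * (B + 1) * τ) := by ring
    omega
  obtain ⟨E₅, hr₅, hle₅⟩ := ((((hr₁.trans hr₂).trans hr₃).trans hr₄)).mono_time htime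
  refine ⟨E₅, hr₅, fun d => ?_⟩
  convert (hk₄ d).mono (hle₅ _) using 2 with ω
  ext t
  simp only [mem_moved (tgt := fun _ => dst), exists_and_right]
  rw [exists_mem_moved, exists_mem_moved, exists_mem_moved]

end Routing

/-! ### Core-periphery networks -/

section Network

open Finset

variable {V : Type} {G : SimpleGraph V} {C : Set V}

/-- One run of the core's schedule for each ordered pair of labels. With the labels fixed, a core
node hosts at most one virtual node, so each ordered pair of core nodes carries at most one message.
-/
theorem EmulatesClique.of_isCliqueEmulator {β : ℕ} (hC : IsCliqueEmulator (G.induce C) β) (w : ℕ)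
    {U : Type} (h : U → C) (l : ℕ) (label : U → ℕ) (hl : ∀ u, label u < l)
    (hinj : ∀ u u', h u = h u' → label u = label u' → u = u') :
    EmulatesClique G w (l * l * β) fun u => (h u : V) := by
  classical
  obtain ⟨σ, hσ, hH⟩ := hC
  intro Ω E D hD
  obtain ⟨E', hr, hE'⟩ := Reach.sequence (G := G) (w := w) (T := β) (E₀ := E)
    (fun i E => ∀ u u', label u = i / l → label u' = i % l →
      Knows (E (h u')) fun ω => D ω (u, u'))
    (fun i E E' hle hq u u' h₁ h₂ => (hq u u' h₁ h₂).mono (hle _)) (l * l) fun i _ E₁ hle => by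
      let D' : Ω → C × C → Message w := fun ω c =>
        if H : ∃ p : U × U, h p.1 = c.1 ∧ label p.1 = i / l ∧ h p.2 = c.2 ∧ label p.2 = i % l then
          D ω H.choose else Message.silent w
      obtain ⟨E₂, hr, hk⟩ := exists_reach_delivery (G := G) (w := w)
        (Function.Embedding.subtype (· ∈ C)) (fun a b hab => hab) hσ E₁ D' (fun c => by
          by_cases H : ∃ p : U × U,
            h p.1 = c.1 ∧ label p.1 = i / l ∧ h p.2 = c.2 ∧ label p.2 = i % l
          · simp only [D', dif_pos H]
            have h₁ : ((h H.choose.1 : C) : V) = c.1 := congrArg Subtype.val H.choose_spec.1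
            change Knows (E₁ (c.1 : V)) _
            exact h₁ ▸ (hD H.choose).mono (hle _)
          · simp only [D', dif_neg H]
            exact Knows.const _) β
      refine ⟨E₂, hr, fun u u' h₁ h₂ => ?_⟩
      have H : ∃ p : U × U,
          h p.1 = h u ∧ label p.1 = i / l ∧ h p.2 = h u' ∧ label p.2 = i % l :=
        ⟨(u, u'), rfl, h₁, rfl, h₂⟩
      have hc : H.choose = (u, u') := by
        obtain ⟨e₁, e₂, e₃, e₄⟩ := H.choose_spec
        exact Prod.ext (hinj _ _ e₁ (e₂.trans h₁.symm)) (hinj _ _ e₃ (e₄.trans h₂.symm))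
      have := hk (h u') (h u, h u') (hH _ _)
      simp only [D', dif_pos H, hc] at this
      exact this
  refine ⟨E', hr, fun ⟨u, u'⟩ => ?_⟩
  have h₁ := hl u
  have h₂ := hl u'
  refine hE' (label u * l + label u') ?_ u u' ?_ ?_
  · calc label u * l + label u' < label u * l + l := by omega
      _ = (label u + 1) * l := by ring
      _ ≤ l * l := Nat.mul_le_mul_right _ h₁
  · rw [mul_comm, Nat.mul_add_div (by omega), Nat.div_eq_of_lt h₂, add_zero]
  · rw [mul_comm, Nat.mul_add_mod, Nat.mod_eq_of_lt h₂]

/-- A square grid is hosted by the elements of a type, at most four points by each. -/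
theorem exists_grid_host (C : Type) [Finite C] [Nonempty C] :
    ∃ q : ℕ, q ≤ Nat.card C + 1 ∧ 0 < q ∧ ∃ (h : Fin q × Fin q → C) (label : Fin q × Fin q → ℕ),
      Function.Surjective h ∧ (∀ u, label u < 4) ∧
        ∀ u u', h u = h u' → label u = label u' → u = u' := by
  obtain ⟨m, ⟨e⟩⟩ := Finite.exists_equiv_fin C
  have hm : Nat.card C = m := by rw [Nat.card_congr e, Nat.card_eq_fintype_card, Fintype.card_fin]
  have hpos : 0 < m := hm ▸ Nat.card_pos
  rw [hm]
  -- With `q = m.sqrt + 1` one has `m < q * q ≤ 4 * m`. Grid points are numbered and wrapped around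
  -- modulo `m`; the label is the number of the turn.
  have h₁ := Nat.sqrt_le m
  have h₃ := Nat.lt_succ_sqrt m
  have h₄ := Nat.sqrt_le_self m
  refine ⟨m.sqrt + 1, by omega, by omega,
    fun u => e.symm ⟨(finProdFinEquiv u : ℕ) % m, Nat.mod_lt _ hpos⟩,
    fun u => (finProdFinEquiv u : ℕ) / m, fun c => ?_, fun u => ?_, fun u u' hu hl => ?_⟩
  · refine ⟨finProdFinEquiv.symm ⟨e c, (e c).2.trans h₃⟩, ?_⟩
    simp only [Equiv.apply_symm_apply, Nat.mod_eq_of_lt (e c).2, Fin.eta, Equiv.symm_apply_apply]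
  · refine Nat.div_lt_of_lt_mul ((finProdFinEquiv u).2.trans_le ?_)
    have : (m.sqrt + 1) * (m.sqrt + 1) = m.sqrt * m.sqrt + 2 * m.sqrt + 1 := by ring
    omega
  · apply finProdFinEquiv.injective
    have hmod : (finProdFinEquiv u : ℕ) % m = (finProdFinEquiv u' : ℕ) % m :=
      congrArg Fin.val (e.symm.injective hu)
    exact Fin.ext (by rw [← Nat.div_add_mod (finProdFinEquiv u : ℕ) m,
      ← Nat.div_add_mod (finProdFinEquiv u' : ℕ) m, hmod, show _ / m = _ / m from hl])

/-- A core node is not its own neighbour, so its inner degree plus one is at most `|C|`; the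
boundary axiom then bounds the outer degree. -/
theorem HasBalancedBoundary.ncard_neighborSet_le [Finite V] {α : ℝ}
    (hC : HasBalancedBoundary G C α) {v : V} (hv : v ∈ C) :
    (G.neighborSet v).ncard ≤ (1 + ⌈α⌉₊) * C.ncard := by
  have h₁ : (G.neighborSet v ∩ C).ncard + 1 ≤ C.ncard := by
    have : v ∉ G.neighborSet v ∩ C := fun h => G.irrefl h.1
    rw [← Set.ncard_insert_of_notMem this]
    exact Set.ncard_le_ncard (Set.insert_subset hv Set.inter_subset_right)
  have h₂ : ((G.neighborSet v \ C).ncard : ℝ) ≤ ⌈α⌉₊ * ((G.neighborSet v ∩ C).ncard + 1) := by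
    have := hC v hv
    rw [div_le_iff₀ (by positivity)] at this
    exact this.trans (mul_le_mul_of_nonneg_right (Nat.le_ceil α) (by positivity))
  have h₃ : (G.neighborSet v \ C).ncard ≤ ⌈α⌉₊ * ((G.neighborSet v ∩ C).ncard + 1) := by
    exact_mod_cast h₂
  have h₄ := Set.ncard_inter_add_ncard_sdiff_eq_ncard (G.neighborSet v) C
  have h₅ := Nat.mul_le_mul_left ⌈α⌉₊ h₁
  rw [add_mul, one_mul]
  omega

/-- In a convergecast, a node of degree `d` receives at most `γ * d` messages. -/
theorem ncard_holds_le [Finite V] {M : Type} {src : M → V} {σ : Schedule V M}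
    (hσ : σ.IsValid G src) (γ : ℕ) (v : V) :
    {μ | src μ ≠ v ∧ Holds src σ γ v μ}.ncard ≤ γ * (G.neighborSet v).ncard := by
  have key : ∀ t μ, src μ ≠ v → Holds src σ t v μ → ∃ i < t, ∃ u, σ i u v = some μ := by
    intro t μ hμ
    induction t with
    | zero => exact fun h => absurd h hμ
    | succ t ih =>
      rintro (h | ⟨u, hu⟩)
      · obtain ⟨i, hi, h⟩ := ih h
        exact ⟨i, by omega, h⟩
      · exact ⟨t, by omega, u, hu⟩
  have : Nonempty V := ⟨v⟩
  -- A message from elsewhere is determined by a round and a neighbour through which it arrives.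
  choose! i hi u hu using key γ
  have hfin : (Set.Iio γ ×ˢ G.neighborSet v).Finite := (Set.finite_Iio γ).prod (Set.toFinite _)
  have := Set.ncard_le_ncard_of_injOn (s := {μ | src μ ≠ v ∧ Holds src σ γ v μ})
    (t := Set.Iio γ ×ˢ G.neighborSet v) (fun μ => (i μ, u μ))
    (fun μ hμ => ⟨hi μ hμ.1 hμ.2, (hσ _ _ _ _ (hu μ hμ.1 hμ.2)).1.symm⟩)
    (fun μ hμ μ' hμ' he => by
      have h₁ := hu μ hμ.1 hμ.2
      have h₂ := hu μ' hμ'.1 hμ'.2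
      simp only [Prod.mk.injEq] at he
      rw [he.1, he.2, h₂] at h₁
      exact (Option.some.inj h₁).symm) hfin
  rwa [Set.ncard_prod, Set.ncard_eq_toFinset_card' (Set.Iio γ), Set.toFinset_Iio, Nat.card_Iio]
    at this

/-- Every node is represented by a node of the core, and these can exchange messages quickly. -/
theorem IsCorePeripheryNetwork.exists_representatives [Finite V] {α : ℝ} {β γ : ℕ}
    (hG : IsCorePeripheryNetwork G C α β γ) (w : ℕ) :
    ∃ rep : V → C, Transfers G w γ id (fun v => (rep v : V)) ∧
      Transfers G w γ (fun v => (rep v : V)) id ∧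
      ∀ c, {v | rep v = c}.ncard ≤ (1 + γ * (1 + ⌈α⌉₊)) * C.ncard := by
  classical
  obtain ⟨σ, hσ, hH⟩ := hG.convergecast
  choose f hf hHf using hH
  let rep : V → C := fun v => if hv : v ∈ C then ⟨v, hv⟩ else ⟨f ⟨v, hv⟩, hf _⟩
  have hin : ∀ v (hv : v ∈ C), (rep v : V) = v := fun v hv => by simp [rep, hv]
  have hout : ∀ μ : ↥Cᶜ, (rep μ : V) = f μ := fun μ => by
    simp only [rep]
    rw [dif_neg μ.2]
  refine ⟨rep, fun Ω E D hD => ?_, fun Ω E D hD => ?_, fun c => ?_⟩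
  · obtain ⟨E', hr, hk⟩ := exists_reach_delivery (G := G) (w := w) (Function.Embedding.refl V)
      (fun _ _ h => h) hσ E (fun ω μ => D ω μ) (fun μ => hD μ) γ
    refine ⟨E', hr, fun v => ?_⟩
    by_cases hv : v ∈ C
    · change Knows (E' (rep v : V)) _
      rw [hin v hv]
      exact hr.knows (hD v)
    · have := hk _ _ (hHf ⟨v, hv⟩)
      rwa [← hout ⟨v, hv⟩] at this
  · obtain ⟨E', hr, hk⟩ := exists_reach_reverse_delivery (G := G) (w := w) hσ
      (fun ω μ => D ω μ) γ E f hHf fun μ => by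
        rw [← hout μ]
        exact hD μ
    refine ⟨E', hr, fun v => ?_⟩
    by_cases hv : v ∈ C
    · have : Knows (E' (rep v : V)) _ := hr.knows (hD v)
      rwa [hin v hv] at this
    · exact hk ⟨v, hv⟩
  · have hsub : {v | rep v = c} ⊆
        insert (c : V) (Subtype.val '' {μ : ↥Cᶜ | (μ : V) ≠ c ∧ Holds Subtype.val σ γ c μ}) := by
      rintro v rfl
      by_cases hv : v ∈ C
      · exact Or.inl (hin v hv).symm
      · refine Or.inr ⟨⟨v, hv⟩, ⟨fun h => hv (by rw [show v = rep v from h]; exact (rep v).2), ?_⟩, rfl⟩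
        rw [show (rep v : V) = _ from hout ⟨v, hv⟩]
        exact hHf _
    have h₁ := (Set.ncard_le_ncard hsub (Set.toFinite _)).trans (Set.ncard_insert_le _ _)
    rw [Set.ncard_image_of_injective _ Subtype.val_injective] at h₁
    have h₂ := h₁.trans (Nat.add_le_add_right (ncard_holds_le hσ γ c) 1)
    have h₃ := Nat.mul_le_mul_left γ (hG.coreBoundary.ncard_neighborSet_le c.2)
    have h₄ : 0 < C.ncard := (Set.ncard_pos (Set.toFinite _)).2 ⟨c, c.2⟩
    have : (1 + γ * (1 + ⌈α⌉₊)) * C.ncard = C.ncard + γ * ((1 + ⌈α⌉₊) * C.ncard) := by ring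
    omega

end Network

/-! ### Matrix transposition -/

section Transposition

open Finset

/-- Routing of the items `X`, which are represented by the tokens `φ p` and located at `loc p`. -/
theorem EmulatesClique.exists_reach_route_items {V Ω Tok ι : Type} {w τ y q : ℕ}
    {G : SimpleGraph V} {h : Fin q × Fin q → V} [Fintype Tok] [DecidableEq Tok] [NeZero q]
    (hG : EmulatesClique G w τ h) (hT : Fits w y (Set.univ : Set (Option Tok)))
    (hU : Fits w 2 (Set.univ : Set (Fin q × Fin q))) (E : View V Ω) (X : Ω → Finset ι)
    (φ : Ω → ι → Tok) (loc : Ω → ι → Fin q × Fin q) (dst : Tok → Fin q × Fin q)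
    (hk : ∀ u, Knows (E (h u)) fun ω => ((X ω).filter fun p => loc ω p = u).image (φ ω)) (B : ℕ)
    (hB : ∀ ω u, ((X ω).filter fun p => loc ω p = u).card ≤ B * (q * q))
    (hB' : ∀ ω d, ((X ω).filter fun p => dst (φ ω p) = d).card ≤ B * (q * q)) :
    ∃ E', Reach G w E (23 * (B + 1) * (y + 2) * τ) E' ∧ ∀ d, Knows (E' (h d)) fun ω =>
      ((X ω).filter fun p => dst (φ ω p) = d).image (φ ω) := by
  obtain ⟨E', hr, hE'⟩ := hG.exists_reach_route hT hU E
    (fun ω u => ((X ω).filter fun p => loc ω p = u).image (φ ω)) dst hk B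
    (fun ω u => card_image_le.trans (hB ω u)) (fun ω d => by
      refine le_trans (sum_le_sum fun u _ => ?_)
        (le_trans (le_of_eq (card_eq_sum_card_fiberwise (f := loc ω) (t := univ)
          fun _ _ => mem_coe.2 (mem_univ _)).symm) (hB' ω d))
      rw [filter_image]
      refine card_image_le.trans (card_le_card fun p => ?_)
      simp only [mem_filter]
      tauto)
  refine ⟨E', hr, fun d => ?_⟩
  convert hE' d using 2 with ω
  ext t
  simp only [mem_moved, mem_image, mem_filter]
  constructor
  · rintro ⟨p, ⟨hp, hd⟩, rfl⟩
    exact ⟨_, ⟨p, ⟨hp, rfl⟩, rfl⟩, hd⟩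
  · rintro ⟨_, ⟨p, ⟨hp, -⟩, rfl⟩, hd⟩
    exact ⟨p, ⟨hp, hd⟩, rfl⟩

theorem Fits.option_prod {A B : Type} {w x y : ℕ} (hA : Fits w x (Set.univ : Set (Option A)))
    (hB : Fits w y (Set.univ : Set (Option B))) :
    Fits w (x + y) (Set.univ : Set (Option (A × B))) := by
  refine (hA.prod hB).of_injOn (fun o => (o.map Prod.fst, o.map Prod.snd))
    (by simp [Set.MapsTo]) ?_
  rintro (_ | ⟨a, b⟩) - (_ | ⟨a', b'⟩) - hab
  · rfl
  · simp at hab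
  · simp at hab
  · simpa using hab

theorem Fits.of_option {A : Type} {w x : ℕ} (hA : Fits w x (Set.univ : Set (Option A))) :
    Fits w x (Set.univ : Set A) :=
  hA.of_injOn some (by simp [Set.MapsTo]) (Option.some_injective A).injOn

variable {n : ℕ} {R : Type} [Zero R]

/-- The number of entries selected by a condition on one of their coordinates. -/
theorem card_filter_coord_le {α κ : Type} [Fintype κ] [DecidableEq κ] (F : Finset α) (f : α → κ)
    {k : ℕ} (hk : ∀ i, (F.filter fun p => f p = i).card ≤ k) (P : κ → Prop) [DecidablePred P] :
    (F.filter fun p => P (f p)).card ≤ k * (univ.filter P).card := by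
  refine card_le_mul_card_image_of_maps_to (f := f) (fun p hp => by
    simpa using (mem_filter.1 hp).2) k fun i _ => le_trans (card_le_card fun p hp => ?_) (hk i)
  simp only [mem_filter] at hp ⊢
  exact ⟨hp.1.1, hp.2⟩

/-- A matrix and an assignment of its rows to the nodes. -/
structure TransposeInput (V : Type) (n : ℕ) (S : Finset R) (k : ℕ) where
  matrix : Matrix (Fin n) (Fin n) R
  row : V ≃ Fin n
  mem : ∀ i j, matrix i j ∈ S
  sparse : IsSparseMatrix matrix k

open Classical in
/-- The positions of the nonzero entries. -/
noncomputable def nonzeroEntries (A : Matrix (Fin n) (Fin n) R) : Finset (Fin n × Fin n) :=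
  univ.filter fun p => A p.1 p.2 ≠ 0

theorem card_nonzeroEntries_row_le {A : Matrix (Fin n) (Fin n) R} {k : ℕ}
    (hA : IsSparseMatrix A k) (i : Fin n) :
    ((nonzeroEntries A).filter fun p => p.1 = i).card ≤ k := by
  refine le_trans ?_ (hA.1 i)
  rw [← Set.ncard_coe_finset]
  refine Set.ncard_le_ncard_of_injOn Prod.snd (fun p hp => ?_) (fun p hp p' hp' he => ?_)
    (Set.toFinite _)
  · simp only [nonzeroEntries, coe_filter, mem_filter, mem_univ, true_and, Set.mem_ofPred_eq] at hp ⊢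
    exact hp.2 ▸ hp.1
  · simp only [coe_filter, Set.mem_ofPred_eq] at hp hp'
    exact Prod.ext (hp.2.trans hp'.2.symm) he

theorem card_nonzeroEntries_col_le {A : Matrix (Fin n) (Fin n) R} {k : ℕ}
    (hA : IsSparseMatrix A k) (j : Fin n) :
    ((nonzeroEntries A).filter fun p => p.2 = j).card ≤ k := by
  refine le_trans ?_ (hA.2 j)
  rw [← Set.ncard_coe_finset]
  refine Set.ncard_le_ncard_of_injOn Prod.fst (fun p hp => ?_) (fun p hp p' hp' he => ?_)
    (Set.toFinite _)
  · simp only [nonzeroEntries, coe_filter, mem_filter, mem_univ, true_and, Set.mem_ofPred_eq] at hp ⊢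
    exact hp.2 ▸ hp.1
  · simp only [coe_filter, Set.mem_ofPred_eq] at hp hp'
    exact Prod.ext he (hp.2.trans hp'.2.symm)

/-- The transposition algorithm for nodes `v` that are represented by the nodes `h (rep v)` of an
emulated clique. -/
theorem EmulatesClique.exists_reach_transpose {V : Type} [Fintype V] {G : SimpleGraph V} {w τ γ y κ k q : ℕ}
    [NeZero q] {h : Fin q × Fin q → V} (hG : EmulatesClique G w τ h)
    (rep : V → Fin q × Fin q) (hup : Transfers G w γ id fun v => h (rep v))
    (hdown : Transfers G w γ (fun v => h (rep v)) id)
    (hrep : ∀ u, {v | rep v = u}.ncard ≤ κ * (q * q)) (hn : n ≤ κ * (q * q) * (q * q))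
    (S : Finset R) (hS : S.Nonempty) (hfin : Fits w 1 (Set.univ : Set (Option (Fin n))))
    (hV : Fits w 1 (Set.univ : Set (Option V)))
    (hfS : Fits w y (Set.univ : Set (Option S)))
    (hU : Fits w 2 (Set.univ : Set (Fin q × Fin q))) :
    ∃ E', Reach G w (fun v (ω ω' : TransposeInput V n S k) =>
        (ω.row v, ω.matrix (ω.row v)) = (ω'.row v, ω'.matrix (ω'.row v)))
      ((1 + k * (y + 3)) * γ + 3 * (23 * ((κ + 1) * (k + 1) + 1) * (y + 5) * τ) +
        k * (y + 3) * γ) E' ∧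
      ∀ v, Knows (E' v) fun ω => ω.matrix.transpose (ω.row v) := by
  classical
  set Ω := TransposeInput V n S k
  set Q := q * q
  set B := (κ + 1) * (k + 1)
  have : Nonempty S := hS.to_subtype
  -- The value outside `S` is arbitrary and irrelevant, as all entries lie in `S`.
  let val : R → S := Function.invFun Subtype.val
  have hval : ∀ r ∈ S, (val r : R) = r := fun r hr =>
    Function.invFun_eq (f := (Subtype.val : S → R)) ⟨⟨r, hr⟩, rfl⟩
  let X : Ω → Finset (Fin n × Fin n) := fun ω => nonzeroEntries ω.matrix
  let φ : Ω → Fin n × Fin n → Fin n × Fin n × S := fun ω p => (p.1, p.2, val (ω.matrix p.1 p.2))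
  have hX : ∀ ω p, p ∈ X ω ↔ ω.matrix p.1 p.2 ≠ 0 := fun ω p => by simp [X, nonzeroEntries]
  -- bounds on the loads
  have hrep' : ∀ u, (univ.filter fun v => rep v = u).card ≤ κ * Q := fun u => by
    rw [← Set.ncard_coe_finset]
    simpa using hrep u
  have hrow : ∀ (ω : Ω) u, (univ.filter fun i => rep (ω.row.symm i) = u).card ≤ κ * Q :=
    fun ω u => by
      refine le_trans (le_of_eq ?_) (hrep' u)
      refine card_bij (fun i _ => ω.row.symm i) (by simp) (by simp) fun v hv => ⟨ω.row v, ?_⟩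
      simpa using hv
  -- `g` says which virtual node is in charge of an index. It does not depend on the input, so every
  -- node knows it.
  obtain ⟨g, hg⟩ := exists_even_map (U := Fin q × Fin q) (univ : Finset (Fin n))
  have hg : ∀ u, (univ.filter fun i => g i = u).card ≤ (κ + 1) * Q := fun u => by
    have hq : 0 < q := Nat.pos_of_ne_zero (NeZero.ne q)
    have hQ : 0 < Q := Nat.mul_pos hq hq
    refine (hg u).trans ?_
    simp only [card_univ, Fintype.card_fin, Fintype.card_prod]
    change n / Q + 1 ≤ _
    have : n / Q ≤ κ * Q := Nat.div_le_of_le_mul (by rw [mul_comm]; exact hn)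
    rw [add_mul]
    omega
  have hB₁ : κ * Q ≤ (κ + 1) * Q := Nat.mul_le_mul_right _ (Nat.le_succ κ)
  have hB₂ : (κ + 1) * Q ≤ B * Q :=
    Nat.mul_le_mul_right _ (Nat.le_mul_of_pos_right _ (Nat.succ_pos k))
  have hB₃ : k * ((κ + 1) * Q) ≤ B * Q := by
    rw [← mul_assoc, mul_comm k]
    exact Nat.mul_le_mul_right _ (Nat.mul_le_mul_left _ (Nat.le_succ k))
  have hB₄ : k * (κ * Q) ≤ B * Q := (Nat.mul_le_mul_left k hB₁).trans hB₃
  have hfst := fun (ω : Ω) => card_filter_coord_le (X ω) Prod.fst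
    (card_nonzeroEntries_row_le ω.sparse)
  have hsnd := fun (ω : Ω) => card_filter_coord_le (X ω) Prod.snd
    (card_nonzeroEntries_col_le ω.sparse)
  -- sizes of the tokens
  have hT : Fits w (y + 2) (Set.univ : Set (Option (Fin n × Fin n × S))) :=
    (hfin.option_prod (hfin.option_prod hfS)).mono le_rfl (by omega)
  have hT₁ : Fits w (y + 3) (Set.univ : Set (Option (V × Fin n × Fin n × S))) :=
    (hV.option_prod hT).mono le_rfl (by omega)
  have hT₂ : Fits w (y + 3) (Set.univ : Set (Option (Fin n × V))) :=
    (hfin.option_prod hV).mono le_rfl (by omega)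
  have hT₀ := hT.mono (subset_refl _) (show y + 2 ≤ y + 3 by omega)
  -- the rows are sent to the representatives
  let F : Ω → V → Finset (Fin n × Fin n × S) := fun ω v =>
    (univ.filter fun j => ω.matrix (ω.row v) j ≠ 0).image
      fun j => (ω.row v, j, val (ω.matrix (ω.row v) j))
  obtain ⟨E₁, hr₁, hk₁⟩ := hup.exists_reach (hfin.of_option.prod (hT₀.finset (N := k)))
    (fun v (ω ω' : Ω) => (ω.row v, ω.matrix (ω.row v)) = (ω'.row v, ω'.matrix (ω'.row v)))
    (fun ω v => (ω.row v, F ω v))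
    (fun ω v => ⟨Set.mem_univ _, card_image_le.trans (by
      have := ω.sparse.1 (ω.row v)
      rwa [Set.ncard_eq_toFinset_card', Set.toFinset_ofPred] at this)⟩)
    (fun v ω ω' hω => by
      have h₁ : ω.row v = ω'.row v := (Prod.mk.inj hω).1
      have h₂ : ω.matrix (ω'.row v) = ω'.matrix (ω'.row v) := h₁ ▸ (Prod.mk.inj hω).2
      simp only [F, h₁, h₂])
  have hk₁' : ∀ u, Knows (E₁ (h u)) fun ω =>
      ((X ω).filter fun p => rep (ω.row.symm p.1) = u).image (φ ω) := by
    intro u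
    have : Knows (E₁ (h u)) fun ω => (univ.filter fun v => rep v = u).biUnion (F ω) := by
      refine fun ω ω' hω => biUnion_congr rfl fun v hv => ?_
      rw [← (mem_filter.1 hv).2] at hω
      exact congrArg Prod.snd (hk₁ v hω)
    convert this using 2 with ω
    ext t
    simp only [mem_image, mem_filter, mem_biUnion, mem_univ, true_and, F, hX]
    constructor
    · rintro ⟨p, ⟨hp, rfl⟩, rfl⟩
      exact ⟨ω.row.symm p.1, rfl, p.2, by simpa using hp, by simp [φ]⟩
    · rintro ⟨v, rfl, j, hj, rfl⟩
      exact ⟨(ω.row v, j), ⟨hj, by simp⟩, rfl⟩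
  have hk₁'' : ∀ u, Knows (E₁ (h u)) fun ω =>
      ((univ : Finset V).filter fun v => rep v = u).image fun v => (ω.row v, v) := by
    refine fun u ω ω' hω => image_congr fun v hv => ?_
    simp only [coe_filter, mem_univ, true_and, Set.mem_ofPred_eq] at hv
    rw [← hv] at hω
    exact congrArg (fun d => (d.1, v)) (hk₁ v hω)
  -- the entries and the locations of the rows are sent to the nodes in charge of the columns
  obtain ⟨E₂, hr₂, hk₂⟩ := hG.exists_reach_route_items hT₀ hU E₁ X φ
    (fun ω p => rep (ω.row.symm p.1)) (fun t => g t.2.1) hk₁' B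
    (fun ω u => (hfst ω fun i => rep (ω.row.symm i) = u).trans
      ((Nat.mul_le_mul_left k (hrow ω u)).trans hB₄))
    (fun ω d => (hsnd ω fun j => g j = d).trans ((Nat.mul_le_mul_left k (hg d)).trans hB₃))
  obtain ⟨E₃, hr₃, hk₃⟩ := hG.exists_reach_route_items hT₂ hU E₂ (fun _ => univ)
    (fun (ω : Ω) v => (ω.row v, v)) (fun _ v => rep v) (fun t => g t.1)
    (fun u => hr₂.knows (hk₁'' u)) B (fun ω u => (hrep' u).trans (hB₁.trans hB₂))
    (fun ω d => by
      refine le_trans (le_of_eq ?_) ((hg d).trans hB₂)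
      exact card_bij (fun v _ => ω.row v) (by simp) (by simp) fun i hi =>
        ⟨ω.row.symm i, by simpa using hi, by simp⟩)
  -- they send the entries to the representatives of the rows of the transpose
  let ψ : Ω → Fin n × Fin n → V × Fin n × Fin n × S := fun ω p => (ω.row.symm p.2, φ ω p)
  have hk₃' : ∀ u, Knows (E₃ (h u)) fun ω => ((X ω).filter fun p => g p.2 = u).image (ψ ω) := by
    intro u
    convert (hr₃.knows (hk₂ u)).comp₂ (hk₃ u)
      (fun D D' => (univ ×ˢ D).filter fun z => (z.2.2.1, z.1) ∈ D') using 2 with ω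
    ext ⟨v, t⟩
    simp only [mem_image, mem_filter, mem_product, mem_univ, true_and, ψ, Prod.mk.injEq]
    constructor
    · rintro ⟨p, ⟨hp, hu⟩, rfl, rfl⟩
      exact ⟨⟨p, ⟨hp, hu⟩, rfl⟩, ω.row.symm p.2, by simpa using hu, by simp [φ]⟩
    · rintro ⟨⟨p, ⟨hp, hu⟩, rfl⟩, v', -, hv, rfl⟩
      exact ⟨p, ⟨hp, hu⟩, by rw [Equiv.symm_apply_eq]; exact hv.symm, rfl⟩
  obtain ⟨E₄, hr₄, hk₄⟩ := hG.exists_reach_route_items hT₁ hU E₃ X ψ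
    (fun ω p => g p.2) (fun t => rep t.1) hk₃' B
    (fun ω d => (hsnd ω fun j => g j = d).trans ((Nat.mul_le_mul_left k (hg d)).trans hB₃))
    (fun ω u => (hsnd ω fun j => rep (ω.row.symm j) = u).trans
      ((Nat.mul_le_mul_left k (hrow ω u)).trans hB₄))
  -- the representatives pass them on
  let F' : Ω → V → Finset (Fin n × Fin n × S) := fun ω v =>
    ((X ω).filter fun p => p.2 = ω.row v).image (φ ω)
  have hk₄' : ∀ v, Knows (E₄ (h (rep v))) fun ω => F' ω v := by
    intro v
    convert (hk₄ (rep v)).comp (fun D => (D.filter fun z => z.1 = v).image Prod.snd) using 2 with ω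
    ext t
    simp only [mem_image, mem_filter, F']
    constructor
    · rintro ⟨p, ⟨hp, hv⟩, rfl⟩
      have hv' : ω.row.symm p.2 = v := by rw [hv, Equiv.symm_apply_apply]
      exact ⟨ψ ω p, ⟨⟨p, ⟨hp, congrArg rep hv'⟩, rfl⟩, hv'⟩, rfl⟩
    · rintro ⟨_, ⟨⟨p, ⟨hp, -⟩, rfl⟩, hv⟩, rfl⟩
      exact ⟨p, ⟨hp, (Equiv.symm_apply_eq _).1 hv⟩, rfl⟩
  obtain ⟨E₅, hr₅, hk₅⟩ := hdown.exists_reach (hT₀.finset (N := k)) E₄ F'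
    (fun ω v => card_image_le.trans (card_nonzeroEntries_col_le ω.sparse _)) hk₄'
  refine ⟨E₅, ?_, fun v ω ω' hω => ?_⟩
  · have := (((hr₁.trans hr₂).trans hr₃).trans hr₄).trans hr₅
    convert this using 1
    ring
  · have key : ∀ ω ω' : Ω, F' ω v = F' ω' v → ∀ i, ω.matrix i (ω.row v) ≠ 0 →
        ω.matrix i (ω.row v) = ω'.matrix i (ω'.row v) := by
      intro ω ω' he i hi
      have hmem : φ ω (i, ω.row v) ∈ F' ω v :=
        mem_image_of_mem _ (mem_filter.2 ⟨(hX ω _).2 hi, rfl⟩)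
      rw [he] at hmem
      obtain ⟨⟨i', j'⟩, hp, hφ⟩ := mem_image.1 hmem
      have hj : j' = ω'.row v := (mem_filter.1 hp).2
      simp only [φ, Prod.mk.injEq] at hφ
      obtain ⟨rfl, -, hv⟩ := hφ
      have := congrArg Subtype.val hv
      rw [hval _ (ω.mem _ _), hval _ (ω'.mem _ _), hj] at this
      exact this.symm
    funext i
    have he : F' ω v = F' ω' v := hk₅ v hω
    change ω.matrix i (ω.row v) = ω'.matrix i (ω'.row v)
    by_cases h₁ : ω.matrix i (ω.row v) = 0
    · by_cases h₂ : ω'.matrix i (ω'.row v) = 0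
      · rw [h₁, h₂]
      · exact (key ω' ω he.symm i h₂).symm
    · exact key ω ω' he i h₁

end Transposition

/-! ### Choice of parameters and the main theorem -/

section Main

open Finset

theorem lt_two_pow_bitLength (n : ℕ) : n + 1 ≤ 2 ^ bitLength n :=
  Nat.lt_pow_succ_log_self one_lt_two n

theorem IsSparseMatrix.eq_zero {n : ℕ} {R : Type} [Zero R] {A : Matrix (Fin n) (Fin n) R}
    (hA : IsSparseMatrix A 0) : A = 0 := by
  ext i j
  by_contra hij
  have := (Set.ncard_eq_zero (Set.toFinite _)).1 (Nat.le_zero.1 (hA.1 i))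
  exact (Set.ext_iff.1 this j).1 hij

/-- The transposition algorithm on core-periphery networks. -/
theorem IsCorePeripheryNetwork.exists_reach_transpose {V : Type} [Fintype V] [Nonempty V]
    {G : SimpleGraph V} {C : Set V} {α : ℝ} {β γ b e : ℕ} (hG : IsCorePeripheryNetwork G C α β γ)
    (hb : 1 ≤ b) {R : Type} [Zero R] (S : Finset R) (hS : S.Nonempty)
    (hSe : S.card ≤ 2 ^ (e * bitLength (Fintype.card V))) (k : ℕ) :
    ∃ E', Reach G (b * bitLength (Fintype.card V))
        (fun v (ω ω' : TransposeInput V (Fintype.card V) S k) =>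
          (ω.row v, ω.matrix (ω.row v)) = (ω'.row v, ω'.matrix (ω'.row v)))
      ((1 + k * (e + 4)) * γ +
        3 * (23 * ((1 + γ * (1 + ⌈α⌉₊) + 1) * (k + 1) + 1) * (e + 6) * (16 * β)) +
          k * (e + 4) * γ) E' ∧
      ∀ v, Knows (E' v) fun ω => ω.matrix.transpose (ω.row v) := by
  classical
  set n := Fintype.card V
  set w := b * bitLength n
  set κ := 1 + γ * (1 + ⌈α⌉₊)
  have hlen : bitLength n ≤ w := Nat.le_mul_of_pos_left _ hb
  have hnw : n + 1 ≤ 2 ^ w :=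
    (lt_two_pow_bitLength n).trans (Nat.pow_le_pow_right two_pos hlen)
  obtain ⟨rep, hup, hdown, hrep⟩ := hG.exists_representatives w
  have : Nonempty C := Nonempty.map rep ‹_›
  obtain ⟨q, hq, hq0, h, label, hsurj, hlabel, hinj⟩ := exists_grid_host C
  have : NeZero q := ⟨hq0.ne'⟩
  have hCn : Nat.card C ≤ n :=
    (Nat.card_le_card_of_injective _ Subtype.val_injective).trans (by simp [n])
  have hCq : C.ncard ≤ q * q := by
    have := Nat.card_le_card_of_surjective h hsurj
    rw [Nat.card_coe_set_eq] at this
    exact this.trans (by simp)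
  choose sec hsec using hsurj
  have hrep' : ∀ u, {v | sec (rep v) = u}.ncard ≤ κ * (q * q) := fun u => by
    refine (Set.ncard_le_ncard (t := {v | rep v = h u}) ?_ (Set.toFinite _)).trans
      ((hrep (h u)).trans (Nat.mul_le_mul_left κ hCq))
    rintro v rfl
    exact (hsec _).symm
  have hn : n ≤ κ * (q * q) * (q * q) := by
    have := card_le_mul_card_image (f := fun v => sec (rep v)) (univ : Finset V) (κ * (q * q))
      fun u _ => by
        rw [← Set.ncard_coe_finset]
        simpa using hrep' u
    refine this.trans (Nat.mul_le_mul_left _ ((card_le_univ _).trans (by simp)))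
  have hopt : ∀ A : Type, Finite A → Nat.card A ≤ n →
      Fits w 1 (Set.univ : Set (Option A)) := fun A _ hA => by
    refine Fits.of_ncard_le Set.finite_univ ?_
    rw [Set.ncard_univ, Finite.card_option]
    omega
  have hfS : Fits w (e + 1) (Set.univ : Set (Option S)) := by
    refine Fits.of_ncard_le_pow Set.finite_univ ?_
    rw [Set.ncard_univ, Finite.card_option, Nat.card_eq_fintype_card, Fintype.card_coe]
    calc S.card + 1 ≤ 2 ^ (e * bitLength n) + 2 ^ (e * bitLength n) :=
          Nat.add_le_add hSe Nat.one_le_two_pow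
      _ = 2 ^ (e * bitLength n) * 2 := by ring
      _ ≤ 2 ^ (e * w) * 2 ^ w := Nat.mul_le_mul
          (Nat.pow_le_pow_right two_pos (Nat.mul_le_mul_left e hlen))
          (le_trans (by have : 0 < n := Fintype.card_pos
                        omega) hnw)
      _ = (2 ^ w) ^ (e + 1) := by ring
  have hU : Fits w 2 (Set.univ : Set (Fin q × Fin q)) := by
    refine Fits.of_ncard_le_pow Set.finite_univ ?_
    have hqw : q ≤ 2 ^ w := by omega
    simpa [Set.ncard_univ, sq] using Nat.mul_le_mul hqw hqw
  have hclique : EmulatesClique G w (4 * 4 * β) fun u => (h u : V) :=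
    EmulatesClique.of_isCliqueEmulator hG.cliqueEmulation w h 4 label hlabel hinj
  exact hclique.exists_reach_transpose (fun v => sec (rep v))
    (by simpa only [hsec] using hup) (by simpa only [hsec] using hdown) hrep' hn S hS
    (hopt _ inferInstance (by simp)) (hopt _ inferInstance (by simp [n])) hfS hU

end Main

/-- The constants are those of the three axioms (`α`, `β`, `γ`), of the message length (`b`), of
the length of matrix entries (`e`), of the sparsity (`s`) and of the success probability (`c`).
Node `v` initially knows row `row v` of `A` together with the index `row v`, and must output row
`row v` of the transpose. -/
theorem mainTheorem5 (α : ℝ) (β γ b e s c : ℕ) (hb : 1 ≤ b) :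
    ∃ K : ℕ, ∀ (V : Type) [Fintype V] (G : SimpleGraph V) (C : Set V),
      IsCorePeripheryNetwork G C α β γ →
      ∀ (R : Type) [Zero R] (S : Finset R), S.card ≤ 2 ^ (e * bitLength (Fintype.card V)) →
      ∀ k : ℕ, ∃ (r : ℕ) (P : Protocol V (b * bitLength (Fintype.card V)) r
          (Fin (Fintype.card V) × (Fin (Fintype.card V) → R)) (Fin (Fintype.card V) → R)),
        ∀ A : Matrix (Fin (Fintype.card V)) (Fin (Fintype.card V)) R,
          (∀ i j, A i j ∈ S) → IsSparseMatrix A (s * k) →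
          ∀ row : V ≃ Fin (Fintype.card V),
            1 - 1 / (Fintype.card V : ℝ) ^ c ≤
              P.successProb G (fun v => (row v, A (row v))) (fun v => A.transpose (row v))
                (K * k) := by
  set κ := 1 + γ * (1 + ⌈α⌉₊)
  refine ⟨(1 + s * (e + 4)) * γ + 3 * (23 * ((κ + 1) * (s + 1) + 1) * (e + 6) * (16 * β)) +
    s * (e + 4) * γ, fun V _ G C hG R _ S hS k => ?_⟩
  set K := (1 + s * (e + 4)) * γ + 3 * (23 * ((κ + 1) * (s + 1) + 1) * (e + 6) * (16 * β)) +
    s * (e + 4) * γ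
  set n := Fintype.card V
  have hreach : ∃ T ≤ K * k, ∃ E', Reach G (b * bitLength n)
      (fun v (ω ω' : TransposeInput V n S (s * k)) =>
        (ω.row v, ω.matrix (ω.row v)) = (ω'.row v, ω'.matrix (ω'.row v))) T E' ∧
      ∀ v, Knows (E' v) fun ω => ω.matrix.transpose (ω.row v) := by
    rcases isEmpty_or_nonempty V with hV | hV
    · exact ⟨0, Nat.zero_le _, _, .refl, fun v => (hV.false v).elim⟩
    rcases S.eq_empty_or_nonempty with rfl | hSne
    · exact ⟨0, Nat.zero_le _, _, .refl, fun v ω => absurd (ω.mem (ω.row v) (ω.row v)) (by simp)⟩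
    -- For `k = 0` no round is available, but the matrix is zero and every node knows its output.
    -- For `k ≥ 1` the additive constants in the running time are absorbed into multiples of `k`.
    rcases Nat.eq_zero_or_pos k with rfl | hk
    · refine ⟨0, Nat.zero_le _, _, .refl, fun v ω ω' _ => ?_⟩
      simp only [ω.sparse.eq_zero, ω'.sparse.eq_zero, Matrix.transpose_zero]
      rfl
    · refine ⟨_, ?_, hG.exists_reach_transpose hb S hSne hS (s * k)⟩
      have h₁ : 1 + s * k * (e + 4) ≤ (1 + s * (e + 4)) * k := by
        have : (1 + s * (e + 4)) * k = k + s * k * (e + 4) := by ring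
        omega
      have h₂ : (κ + 1) * (s * k + 1) + 1 ≤ ((κ + 1) * (s + 1) + 1) * k := by
        have h₃ : (κ + 1) * (s * k + 1) ≤ (κ + 1) * ((s + 1) * k) :=
          Nat.mul_le_mul_left _ (by rw [add_mul]; omega)
        have : ((κ + 1) * (s + 1) + 1) * k = (κ + 1) * ((s + 1) * k) + k := by ring
        omega
      calc _ ≤ (1 + s * (e + 4)) * k * γ +
            3 * (23 * (((κ + 1) * (s + 1) + 1) * k) * (e + 6) * (16 * β)) +
              s * k * (e + 4) * γ := by gcongr
        _ = K * k := by ring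
  obtain ⟨T, hT, E', hr, hk⟩ := hreach
  obtain ⟨E'', hr', hle⟩ := hr.mono_time hT
  have : Inhabited (Fin n → R) := ⟨0⟩
  obtain ⟨P, hP⟩ := hr'.exists_protocol (input := fun (ω : TransposeInput V n S (s * k)) v => (ω.row v, ω.matrix (ω.row v)))
    (target := fun ω v => ω.matrix.transpose (ω.row v)) fun v => (hk v).mono (hle v)
  refine ⟨0, P, fun A hA hsp row => ?_⟩
  rw [successProb_eq_one P _ _ _ (hP ⟨A, row, hA, hsp⟩)]
  exact sub_le_self _ (by positivity)
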